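/- Consider the parallel Galton--Watson algorithm with threshold $t\in\mathbb N$. Each running thread has two linear data structures $\mathrm{lds}_1,\mathrm{lds}_2$ of pending nodes, and at the start there is one thread, with $\mathrm{lds}_1$ holding only the root and $\mathrm{lds}_2$ empty. Nodes are treated one at a time: some running thread removes a node from its $\mathrm{lds}_2$ (from its $\mathrm{lds}_1$ if $\mathrm{lds}_2$ is empty) and draws a fair random bit, all bits being independent. With probability $1/2$ the node is a leaf. With probability $1/2$ it receives two children, which are pushed into $\mathrm{lds}_1$ if $|\mathrm{lds}_1|<t$, and otherwise into $\mathrm{lds}_2$; in the latter case, if then $|\mathrm{lds}_2|\ge t$, the content of $\mathrm{lds}_2$ becomes the $\mathrm{lds}_1$ of a new thread and $\mathrm{lds}_2$ is emptied. A thread ends when its $\mathrm{lds}_1$ is empty. Which thread moves next and which element of the data structure is removed may depend in any way on the bits drawn so far. The total load after $k$ treated nodes is the number $S_k$ of pending nodes in all threads together ($S_0=1$), and the peak total load is $P=\max_k S_k$. The algorithm generates a tree of size $n$ if it stops having produced a binary tree with $n$ internal nodes (hence $2n+1$ nodes in all). **Theorem.** Fix any threshold and any such scheduling. 1. For every run that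 generates a tree of size $n$, the path $0,S_0,S_1,\dots,S_{2n+1}=0$ is the Dyck path of length $2n+2$ whose first step is up and whose following $2n+1$ steps are given by the random bits (up for an internal node, down for a leaf). It is positive except at its two ends, i.e. an excursion, and the peak total load $P$ is its maximum height. 2. The event of generating a tree of size $n$ has positive probability for every $n$. Let $P_n$ be $P$ conditioned on this event. Then $P_n$ is integrable and $$\mathbb E[P_n]\sim\sqrt{\pi n}\qquad(n\to\infty).$$ 3. There is a probability measure on $(0,\infty)$, the Theta law, with $$\mathbb P(X\ge x)=\Theta(x):=\sum_{k\ge1}(4k^2x^2-2)\,e^{-k^2x^2}\qquad(x>0)$$ for $X$ distributed according to it; it has mean $\mathbb E[X]=\sqrt\pi$, and $$\frac{P_n}{\sqrt n}\longrightarrow X\quad\text{in distribution.}$$ Equivalently, $\dfrac{P_n}{2\sqrt{\pi n}}\longrightarrow\dfrac{X}{2\sqrt\pi}$ in distribution, which is a Theta law up to a constant scale factor. -/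

import Mathlib

namespace ParallelGW

/-- A node of a rooted planar binary tree, given by its address: the root is `[]`, and the two
children of `v` are `false :: v` and `true :: v`. -/
abbrev Node := List Bool

/-- A thread of the algorithm, with its two linear data structures of nodes still to be
treated. -/
structure Thread where
  lds₁ : List Node
  lds₂ : List Node

/-- The state of the algorithm: the threads that are still running, and the nodes of the tree
that have been given two children so far (the internal nodes). -/
structure State where
  threads : List Thread
  internal : List Node

/-- A thread stops as soon as its first linear data structure is empty. -/
def keepRunning (ts : List Thread) : List Thread :=
  ts.filter (fun th => !th.lds₁.isEmpty)

/-- The linear data structure from which the next node is taken: the first one if the second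
one is empty, the second one otherwise. -/
def Thread.source (th : Thread) : List Node :=
  if th.lds₂.isEmpty then th.lds₁ else th.lds₂

/-- The node that is popped when the position `j` (modulo the length) is asked for. -/
def Thread.popped (th : Thread) (j : ℕ) : Node :=
  th.source.getD (j % th.source.length) []

/-- The thread once this node has been popped. -/
def Thread.afterPop (th : Thread) (j : ℕ) : Thread :=
  if th.lds₂.isEmpty then ⟨th.lds₁.eraseIdx (j % th.lds₁.length), th.lds₂⟩
  else ⟨th.lds₁, th.lds₂.eraseIdx (j % th.lds₂.length)⟩

/-- Add the two children of `v` to the pending nodes of a thread, for the threshold `t`: push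
them into the first linear data structure if it has fewer than `t` elements, and otherwise into
the second one; if the latter then has at least `t` elements, it is handed over to a new
thread. -/
def Thread.pushChildren (t : ℕ) (th : Thread) (v : Node) : List Thread :=
  if th.lds₁.length < t then
    [⟨(false :: v) :: (true :: v) :: th.lds₁, th.lds₂⟩]
  else if t ≤ ((false :: v) :: (true :: v) :: th.lds₂).length then
    [⟨th.lds₁, []⟩, ⟨(false :: v) :: (true :: v) :: th.lds₂, []⟩]
  else
    [⟨th.lds₁, (false :: v) :: (true :: v) :: th.lds₂⟩]

/-- One iteration of the loop of one running thread. The scheduler's choice `c` says which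
thread moves (`c.1`, modulo the number of running threads) and the position of the node that it
pops (`c.2`, modulo the size of the data structure); `b` is the random bit that is drawn. Nothing
happens once no thread is running. -/
def step (t : ℕ) (c : ℕ × ℕ) (b : Bool) (s : State) : State :=
  match s.threads[c.1 % s.threads.length]? with
  | none => s
  | some th =>
    let v := th.popped c.2
    let th' := th.afterPop c.2
    let rest := s.threads.eraseIdx (c.1 % s.threads.length)
    if b then ⟨keepRunning (th'.pushChildren t v) ++ rest, v :: s.internal⟩
    else ⟨keepRunning [th'] ++ rest, s.internal⟩

/-- The state of the algorithm with threshold `t` after `k` nodes have been treated, when the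
random bits are `β 0, β 1, …` and the scheduler (which thread moves next, and which element its
linear data structure returns) is the function `σ` of the bits drawn so far. At the start a
single thread holds the root. -/
def state (t : ℕ) (σ : List Bool → ℕ × ℕ) (β : ℕ → Bool) : ℕ → State
  | 0 => ⟨[⟨[[]], []⟩], []⟩
  | k + 1 => step t (σ ((List.range k).map β)) (β k) (state t σ β k)

/-- The total load: the number of pending nodes in all threads together. -/
def State.load (s : State) : ℕ :=
  (s.threads.map (fun th => th.lds₁.length + th.lds₂.length)).sum

/-- The algorithm stops, and the tree it returns has `n` internal nodes. -/
def Generates (t : ℕ) (σ : List Bool → ℕ × ℕ) (n : ℕ) (β : ℕ → Bool) : Prop :=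
  ∃ k, (state t σ β k).threads = [] ∧ (state t σ β k).internal.length = n

/-- The peak total load: the maximum over time of the total load. (It is only used for runs that
stop, for which the set is finite.) -/
noncomputable def peakLoad (t : ℕ) (σ : List Bool → ℕ × ℕ) (β : ℕ → Bool) : ℕ :=
  sSup (Set.range (fun k => (state t σ β k).load))

/-- The height reached by a Dyck path after `i` steps. The truncated subtraction is exact, as a
prefix of a Dyck word has at least as many up steps as down steps. -/
def heightAt (p : DyckWord) (i : ℕ) : ℕ :=
  (p.toList.take i).count DyckStep.U - (p.toList.take i).count DyckStep.D

/-- The maximum height of a Dyck path. -/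
def height (p : DyckWord) : ℕ :=
  (Finset.range (p.toList.length + 1)).sup (heightAt p)

/-- The Dyck step coded by a random bit: up if two children are generated, down if the node is a
leaf. -/
def dyckStep (b : Bool) : DyckStep := if b then DyckStep.U else DyckStep.D

/-- The function `Θ(x) = ∑_{k ≥ 1} (4 k² x² - 2) exp (-k² x²)`. -/
noncomputable def thetaTail (x : ℝ) : ℝ :=
  ∑' k : ℕ, (4 * ((k : ℝ) + 1) ^ 2 * x ^ 2 - 2) * Real.exp (-(((k : ℝ) + 1) ^ 2 * x ^ 2))

/-- The Theta law: the probability distribution on the positive reals with tail function `Θ`. -/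
def IsThetaLaw (ν : MeasureTheory.Measure ℝ) : Prop :=
  MeasureTheory.IsProbabilityMeasure ν ∧ ν (Set.Iic 0) = 0 ∧
    ∀ x : ℝ, 0 < x → ν.real (Set.Ici x) = thetaTail x

end ParallelGW

/-! The threads do not matter. A node is taken from `lds₁` only when `lds₂` is empty, so a thread
that ends leaves nothing behind, and until it hits 0 the total load moves by +1 or -1 as dictated by
the current bit alone (`load_state_succ`). Threshold and scheduler disappear: the load is a simple
random walk started at 1 and absorbed at 0, and conditioning on size n makes it, with an up step put
in front, a uniform excursion of length 2N, where N = n + 1.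

Excursions with maximum below H are walks in a strip. Reflection in the two barriers writes their
number as a difference of walk counts on a cycle of length 2H (`bitCount_staysBelow`); unrolling the
cycle gives -1/2 times the sum over all integers k of the second difference of the binomial row 2n
at kH (`bitCount_staysBelow_eq`). This second difference at j is a multiple of (4j² - 2N) C(2N, N+j)
(`secondDiff_natCast`). The term k = 0 accounts for all excursions, so division by their number
yields the exact tail: the sum over k ≥ 1 of (4k²H²/N - 2) C(2N, N+kH)/C(2N, N)
(`hasSum_excursionTail`).

For H ~ x√n the binomial ratios tend to exp(-k²x²) (`tendsto_binomRatio`), and a 1/k² majorant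
allows the limit under the sum, which gives Θ(x). As a limit of tails, Θ is antitone with values in
[0, 1]. Moreover -Θ is the derivative of 2x ∑ exp(-k²x²), which by Jacobi's theta identity is √π - x
+ O(x²) at 0+ and tends to 0 at infinity. The value √π is the integral of Θ, hence the mean of the
law; the slope -1 gives Θ(0+) = 1, so no mass is lost at 0. The means converge because they are
integrals of the tails, dominated by a multiple of 1/(1 + x²). -/

namespace ParallelGW

/-! ### The total load as a walk driven by the bits -/

/-- Every running thread has a pending node in its first linear data structure. -/
def State.WellFormed (s : State) : Prop := ∀ th ∈ s.threads, th.lds₁ ≠ []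

/-- The number of pending nodes of a thread. -/
def Thread.load (th : Thread) : ℕ := th.lds₁.length + th.lds₂.length

lemma State.load_eq (s : State) : s.load = (s.threads.map Thread.load).sum := rfl

lemma mem_keepRunning {ts : List Thread} {th : Thread} :
    th ∈ keepRunning ts ↔ th ∈ ts ∧ th.lds₁ ≠ [] := by
  simp [keepRunning]

/-- No pending node is lost when ended threads are discarded, provided an empty `lds₁` forces an
empty `lds₂`. The provision is checked below for both kinds of move. -/
lemma sum_load_keepRunning (ts : List Thread) (h : ∀ th ∈ ts, th.lds₁ = [] → th.lds₂ = []) :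
    ((keepRunning ts).map Thread.load).sum = (ts.map Thread.load).sum := by
  induction ts with
  | nil => rfl
  | cons a ts ih =>
    have ih := ih fun th hth => h th (List.mem_cons_of_mem _ hth)
    have ha := h a List.mem_cons_self
    unfold keepRunning at ih ⊢
    by_cases h1 : a.lds₁ = []
    · simp [h1, ih, Thread.load, ha h1]
    · simp [h1, ih]

lemma State.WellFormed.load_eq_zero_iff {s : State} (hs : s.WellFormed) :
    s.load = 0 ↔ s.threads = [] := by
  rw [State.load_eq]
  cases h : s.threads with
  | nil => simp
  | cons a ts =>
    have : a.lds₁ ≠ [] := hs a (by simp [h])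
    have := List.length_pos_iff.2 this
    simp only [List.map_cons, List.sum_cons, Thread.load, reduceCtorEq, iff_false]
    omega

lemma Thread.load_afterPop {th : Thread} (h : th.lds₁ ≠ []) (j : ℕ) :
    (th.afterPop j).load + 1 = th.load := by
  have h1 := List.length_pos_iff.2 h
  unfold Thread.afterPop Thread.load
  split_ifs with h2
  · have := Nat.mod_lt j h1
    simp only [List.length_eraseIdx, this, if_true]
    omega
  · have h2 : 0 < th.lds₂.length := List.length_pos_iff.2 (by simpa using h2)
    have := Nat.mod_lt j h2
    simp only [List.length_eraseIdx, this, if_true]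
    omega

lemma Thread.lds₂_afterPop {th : Thread} (h : th.lds₁ ≠ []) (j : ℕ)
    (h0 : (th.afterPop j).lds₁ = []) : (th.afterPop j).lds₂ = [] := by
  unfold Thread.afterPop at h0 ⊢
  split_ifs at h0 ⊢ with h2
  · simpa using h2
  · exact absurd h0 h

lemma sum_load_pushChildren (t : ℕ) (th : Thread) (v : Node) :
    ((th.pushChildren t v).map Thread.load).sum = th.load + 2 := by
  unfold Thread.pushChildren
  split_ifs <;> simp [Thread.load] <;> omega

lemma lds₂_of_mem_pushChildren {t : ℕ} {th : Thread} (v : Node)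
    {th' : Thread} (h' : th' ∈ th.pushChildren t v) (h0 : th'.lds₁ = []) : th'.lds₂ = [] := by
  unfold Thread.pushChildren at h'
  split_ifs at h' with h1 h2
  · simp only [List.mem_singleton] at h'
    subst h'
    simp at h0
  · simp only [List.mem_cons, List.not_mem_nil, or_false] at h'
    rcases h' with rfl | rfl
    · rfl
    · rfl
  -- In this branch an empty `lds₁` forces `t = 0`, and then the test `t ≤ ...` could not have
  -- failed.
  · simp only [List.mem_singleton] at h'
    subst h'
    simp only at h0
    simp [h0] at h1 h2
    omega

lemma step_of_threads_eq_nil {t : ℕ} {c : ℕ × ℕ} {b : Bool} {s : State} (h : s.threads = []) :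
    step t c b s = s := by
  simp [step, h]

lemma State.WellFormed.step {s : State} (hs : s.WellFormed) (t : ℕ) (c : ℕ × ℕ) (b : Bool) :
    (step t c b s).WellFormed := by
  unfold ParallelGW.step
  split
  · exact hs
  · intro th hth
    have key : ∀ l : List Thread, ∀ i,
        th ∈ keepRunning l ++ s.threads.eraseIdx i → th.lds₁ ≠ [] := by
      intro l i h
      rcases List.mem_append.1 h with h | h
      · exact (mem_keepRunning.1 h).2
      · exact hs th (List.mem_of_mem_eraseIdx h)
    cases b
    · exact key _ _ hth
    · exact key _ _ hth

lemma State.WellFormed.load_step {s : State} (hs : s.WellFormed) (h : s.threads ≠ []) (t : ℕ)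
    (c : ℕ × ℕ) (b : Bool) :
    (ParallelGW.step t c b s).load + 1 = s.load + (if b then 2 else 0) ∧
      (ParallelGW.step t c b s).internal.length = s.internal.length + (if b then 1 else 0) := by
  have hi := Nat.mod_lt c.1 (List.length_pos_iff.2 h)
  have hth := hs _ (List.getElem_mem hi)
  have hsum : s.load = s.threads[c.1 % s.threads.length].load +
      ((s.threads.eraseIdx (c.1 % s.threads.length)).map Thread.load).sum := by
    rw [State.load_eq, ← ((List.getElem_cons_eraseIdx_perm hi).map Thread.load).sum_eq]
    simp
  unfold ParallelGW.step
  rw [List.getElem?_eq_getElem hi]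
  have hpop := Thread.load_afterPop hth c.2
  have hl := Thread.lds₂_afterPop hth c.2
  cases b
  · simp only [Bool.false_eq_true, if_false, State.load_eq _, List.map_append, List.sum_append]
    rw [sum_load_keepRunning _ (by simpa using hl), ← State.load_eq, hsum]
    simp
    omega
  · simp only [if_true, State.load_eq _, List.map_append, List.sum_append]
    rw [sum_load_keepRunning _ (fun th' h' h0 => lds₂_of_mem_pushChildren _ h' h0),
      sum_load_pushChildren, ← State.load_eq, hsum]
    simp
    omega

variable {t : ℕ} {σ : List Bool → ℕ × ℕ} {β : ℕ → Bool}

lemma wellFormed_state (t : ℕ) (σ : List Bool → ℕ × ℕ) (β : ℕ → Bool) (k : ℕ) :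
    (state t σ β k).WellFormed := by
  induction k with
  | zero => intro th hth; simp only [state, List.mem_singleton] at hth; simp [hth]
  | succ k ih => exact ih.step _ _ _

lemma load_state_zero : (state t σ β 0).load = 1 := rfl

lemma load_state_eq_zero_iff {k : ℕ} :
    (state t σ β k).load = 0 ↔ (state t σ β k).threads = [] :=
  (wellFormed_state t σ β k).load_eq_zero_iff

lemma state_succ_of_load_eq_zero {k : ℕ} (h : (state t σ β k).load = 0) :
    state t σ β (k + 1) = state t σ β k :=
  step_of_threads_eq_nil (load_state_eq_zero_iff.1 h)

lemma state_eq_of_load_eq_zero {k l : ℕ} (h : (state t σ β k).load = 0) (hkl : k ≤ l) :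
    state t σ β l = state t σ β k := by
  induction l, hkl using Nat.le_induction with
  | base => rfl
  | succ l _ ih => rw [state_succ_of_load_eq_zero (by rw [ih, h]), ih]

lemma load_state_succ {k : ℕ} (h : 0 < (state t σ β k).load) :
    (state t σ β (k + 1)).load =
      if β k then (state t σ β k).load + 1 else (state t σ β k).load - 1 := by
  have := ((wellFormed_state t σ β k).load_step
    (fun h0 => h.ne' (load_state_eq_zero_iff.2 h0)) t (σ ((List.range k).map β)) (β k)).1
  change (state t σ β (k + 1)).load + 1 = _ at this
  split_ifs at this ⊢ <;> omega

/-- Each treated node costs one unit of load and each internal node brings two. So a run of size n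
can only stop at time 2n + 1. -/
lemma load_add_eq {k : ℕ} (h : ∀ j < k, 0 < (state t σ β j).load) :
    (state t σ β k).load + k = 1 + 2 * (state t σ β k).internal.length := by
  induction k with
  | zero => rfl
  | succ k ih =>
    have ih := ih fun j hj => h j (by omega)
    have := (wellFormed_state t σ β k).load_step
      (fun h0 => (h k (by omega)).ne' (load_state_eq_zero_iff.2 h0)) t
      (σ ((List.range k).map β)) (β k)
    change (state t σ β (k + 1)).load + 1 = _ ∧
      (state t σ β (k + 1)).internal.length = _ at this
    split_ifs at this <;> omega

lemma generates_iff {n : ℕ} :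
    Generates t σ n β ↔ (state t σ β (2 * n + 1)).load = 0 ∧
      ∀ k < 2 * n + 1, 0 < (state t σ β k).load := by
  constructor
  · rintro ⟨k, hk, hn⟩
    have hk := load_state_eq_zero_iff.2 hk
    classical
    have hex : ∃ k, (state t σ β k).load = 0 := ⟨k, hk⟩
    have hT := Nat.find_spec hex
    have hlt : ∀ j < Nat.find hex, 0 < (state t σ β j).load :=
      fun j hj => Nat.pos_of_ne_zero (Nat.find_min hex hj)
    have h1 := load_add_eq hlt
    -- The state is frozen after the first hitting time of 0, so the tree size may be read off
    -- there.
    have h2 := state_eq_of_load_eq_zero hT (Nat.find_min' hex hk)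
    rw [h2] at hn
    have : Nat.find hex = 2 * n + 1 := by omega
    rw [this] at hT hlt
    exact ⟨hT, hlt⟩
  · rintro ⟨h0, h⟩
    have := load_add_eq h
    exact ⟨2 * n + 1, load_state_eq_zero_iff.1 h0, by omega⟩

lemma load_le (k : ℕ) : (state t σ β k).load ≤ k + 1 := by
  induction k with
  | zero => exact le_rfl
  | succ k ih =>
    rcases Nat.eq_zero_or_pos (state t σ β k).load with h | h
    · rw [state_succ_of_load_eq_zero h]; omega
    · rw [load_state_succ h]; split_ifs <;> omega

lemma Generates.load_le {n : ℕ} (h : Generates t σ n β) (k : ℕ) :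
    (state t σ β k).load ≤ 2 * n + 2 := by
  rcases le_total k (2 * n + 1) with hk | hk
  · exact (ParallelGW.load_le k).trans (by omega)
  · rw [state_eq_of_load_eq_zero (generates_iff.1 h).1 hk, (generates_iff.1 h).1]; omega

lemma Generates.bddAbove {n : ℕ} (h : Generates t σ n β) :
    BddAbove (Set.range fun k => (state t σ β k).load) :=
  ⟨2 * n + 2, by rintro _ ⟨k, rfl⟩; exact h.load_le k⟩

lemma Generates.peakLoad_le_iff {n m : ℕ} (h : Generates t σ n β) :
    peakLoad t σ β ≤ m ↔ ∀ k, (state t σ β k).load ≤ m := by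
  rw [peakLoad, csSup_le_iff h.bddAbove (Set.range_nonempty _)]
  simp

/-- The `+ 1` stands for the root, that is, for the up step put in front of the bits in the
excursion. -/
lemma count_U_prefix {n : ℕ} (h : Generates t σ n β) {k : ℕ} (hk : k ≤ 2 * n + 1) :
    ((List.range k).map fun k => dyckStep (β k)).count DyckStep.U + 1 =
      ((List.range k).map fun k => dyckStep (β k)).count DyckStep.D + (state t σ β k).load := by
  induction k with
  | zero => rfl
  | succ k ih =>
    have ih := ih (by omega)
    have hpos := (generates_iff.1 h).2 k (by omega)
    rw [load_state_succ hpos, List.range_succ, List.map_append, List.count_append,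
      List.count_append]
    have h1 : ∀ x : DyckStep, ([k].map fun k => dyckStep (β k)).count x =
        if dyckStep (β k) = x then 1 else 0 := fun x => by simp [List.count_singleton]
    rw [h1, h1, show dyckStep (β k) = if β k then DyckStep.U else DyckStep.D from rfl]
    cases hb : β k <;> simp <;> omega

lemma take_excursion (β : ℕ → Bool) (m k : ℕ) :
    ((DyckStep.U :: (List.range m).map fun k => dyckStep (β k)).take (k + 1)) =
      DyckStep.U :: (List.range (min k m)).map fun k => dyckStep (β k) := by
  rw [List.take_succ_cons, ← List.map_take, List.take_range]

/-- The excursion of a run that generates a tree of size `n`. -/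
def Generates.excursion {n : ℕ} (h : Generates t σ n β) : DyckWord where
  toList := DyckStep.U :: (List.range (2 * n + 1)).map (fun k => dyckStep (β k))
  count_U_eq_count_D := by
    have := count_U_prefix h le_rfl
    rw [(generates_iff.1 h).1] at this
    simpa using this
  count_D_le_count_U i := by
    rcases i with _ | i
    · simp
    · have := count_U_prefix h (min_le_right i (2 * n + 1))
      rw [take_excursion]
      simp
      omega

lemma Generates.heightAt_excursion {n : ℕ} (h : Generates t σ n β) {k : ℕ}
    (hk : k ≤ 2 * n + 1) : heightAt h.excursion (k + 1) = (state t σ β k).load := by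
  have := count_U_prefix h hk
  simp only [heightAt, excursion, take_excursion, min_eq_left hk]
  simp
  omega

lemma Generates.semilength_excursion {n : ℕ} (h : Generates t σ n β) :
    h.excursion.semilength = n + 1 := by
  have h1 := h.excursion.two_mul_semilength_eq_length
  have h2 : h.excursion.toList.length = 2 * n + 1 + 1 := by simp [excursion]
  omega

lemma Generates.isNested_excursion {n : ℕ} (h : Generates t σ n β) : h.excursion.IsNested := by
  refine ⟨fun h0 => ?_, fun i hi hi' => ?_⟩
  · have := congrArg DyckWord.semilength h0
    simp [h.semilength_excursion] at this
  · obtain ⟨k, rfl⟩ : ∃ k, i = k + 1 := ⟨i - 1, by omega⟩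
    simp only [excursion, List.length_cons, List.length_map, List.length_range] at hi'
    have := count_U_prefix h (k := k) (by omega)
    have hp := (generates_iff.1 h).2 k (by omega)
    simp only [excursion, take_excursion, min_eq_left (show k ≤ 2 * n + 1 by omega)]
    simp
    omega

lemma Generates.peakLoad_eq_height {n : ℕ} (h : Generates t σ n β) :
    peakLoad t σ β = height h.excursion := by
  apply le_antisymm
  · rw [h.peakLoad_le_iff]
    intro k
    rcases le_total k (2 * n + 1) with hk | hk
    · rw [← h.heightAt_excursion hk]
      exact Finset.le_sup (f := heightAt h.excursion) (by simp [excursion]; omega)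
    · rw [state_eq_of_load_eq_zero (generates_iff.1 h).1 hk, (generates_iff.1 h).1]
      exact zero_le
  · refine Finset.sup_le fun i hi => ?_
    rcases i with _ | k
    · simp [heightAt]
    · simp only [excursion, List.length_cons, List.length_map, List.length_range,
        Finset.mem_range] at hi
      rw [h.heightAt_excursion (by omega)]
      exact h.peakLoad_le_iff.1 le_rfl k

/-- The walk started at `i` whose steps are the given bits hits `0` for the first time at its end
and stays below `H` before. -/
def StaysBelow (H : ℕ) : ℕ → List Bool → Prop
  | i, [] => i = 0
  | i, b :: l => (0 < i ∧ i < H) ∧ StaysBelow H (if b then i + 1 else i - 1) l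

/-- The start time `s` is free so that the induction on `m` can peel off the first bit. -/
lemma staysBelow_iff (H m s : ℕ) :
    StaysBelow H (state t σ β s).load ((List.range' s m).map β) ↔
      (state t σ β (s + m)).load = 0 ∧
        ∀ k < m, 0 < (state t σ β (s + k)).load ∧ (state t σ β (s + k)).load < H := by
  induction m generalizing s with
  | zero => simp [StaysBelow]
  | succ m ih =>
    rw [List.range'_succ, List.map_cons, StaysBelow]
    have hsplit : (∀ k < m + 1, 0 < (state t σ β (s + k)).load ∧ (state t σ β (s + k)).load < H) ↔
        (0 < (state t σ β s).load ∧ (state t σ β s).load < H) ∧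
        ∀ k < m, 0 < (state t σ β (s + 1 + k)).load ∧ (state t σ β (s + 1 + k)).load < H := by
      constructor
      · intro h
        refine ⟨h 0 (by omega), fun k hk => ?_⟩
        have := h (k + 1) (by omega)
        rwa [show s + 1 + k = s + (k + 1) by omega]
      · rintro ⟨h0, h⟩ k hk
        rcases k with _ | k
        · exact h0
        · rw [show s + (k + 1) = s + 1 + k by omega]; exact h k (by omega)
    rw [hsplit, show s + (m + 1) = s + 1 + m by omega]
    by_cases h0 : 0 < (state t σ β s).load
    · rw [← load_state_succ h0, ih]
      tauto
    · tauto

lemma generates_and_peakLoad_lt_iff {n H : ℕ} (hH : 1 ≤ H) :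
    (Generates t σ n β ∧ peakLoad t σ β < H) ↔
      StaysBelow H 1 ((List.range' 0 (2 * n + 1)).map β) := by
  have := staysBelow_iff (t := t) (σ := σ) (β := β) H (2 * n + 1) 0
  rw [load_state_zero] at this
  simp only [zero_add] at this
  rw [this]
  constructor
  · rintro ⟨h, hp⟩
    refine ⟨(generates_iff.1 h).1, fun k hk => ⟨(generates_iff.1 h).2 k hk, ?_⟩⟩
    exact lt_of_le_of_lt (h.peakLoad_le_iff.1 le_rfl k) hp
  · rintro ⟨h0, h⟩
    have hg : Generates t σ n β := generates_iff.2 ⟨h0, fun k hk => (h k hk).1⟩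
    refine ⟨hg, ?_⟩
    have : peakLoad t σ β ≤ H - 1 := by
      rw [hg.peakLoad_le_iff]
      intro k
      rcases lt_or_ge k (2 * n + 1) with hk | hk
      · have := (h k hk).2; omega
      · rw [state_eq_of_load_eq_zero h0 hk, h0]; omega
    omega

/-- A run of size n never exceeds load 2n + 2, so the barrier 2n + 3 is no constraint. The
conditioning event becomes an instance of the strip event. -/
lemma generates_iff_staysBelow {n : ℕ} :
    Generates t σ n β ↔ StaysBelow (2 * n + 3) 1 ((List.range' 0 (2 * n + 1)).map β) := by
  rw [← generates_and_peakLoad_lt_iff (t := t) (σ := σ) (by omega)]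
  refine ⟨fun h => ⟨h, ?_⟩, fun h => h.1⟩
  have := h.peakLoad_le_iff.2 h.load_le
  omega

lemma state_congr {β' : ℕ → Bool} {k : ℕ} (h : ∀ j < k, β j = β' j) :
    state t σ β k = state t σ β' k := by
  induction k with
  | zero => rfl
  | succ k ih =>
    have hl : (List.range k).map β = (List.range k).map β' :=
      List.map_congr_left fun j hj => h j (by simp at hj; omega)
    simp only [state, ih fun j hj => h j (by omega), hl, h k (by omega)]

end ParallelGW

/-! ### Walks in a strip: reflection principle and second differences of binomial coefficients -/

namespace ParallelGW

open scoped Classical in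
/-- The number of lists of `m` bits with the property `p`. -/
noncomputable def bitCount : ℕ → (List Bool → Prop) → ℕ
  | 0, p => if p [] then 1 else 0
  | m + 1, p => bitCount m (fun l => p (true :: l)) + bitCount m (fun l => p (false :: l))

lemma bitCount_false (m : ℕ) : bitCount m (fun _ => False) = 0 := by
  induction m with
  | zero => simp [bitCount]
  | succ m ih => simp [bitCount, ih]

/-- The number of walks of length `m` from `0` to `d` on the cycle of length `L`. -/
def cycleCount (L : ℕ) : ℕ → ℤ → ℤ
  | 0, d => if (L : ℤ) ∣ d then 1 else 0
  | m + 1, d => cycleCount L m (d - 1) + cycleCount L m (d + 1)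

lemma cycleCount_neg (L m : ℕ) (d : ℤ) : cycleCount L m (-d) = cycleCount L m d := by
  induction m generalizing d with
  | zero => simp [cycleCount]
  | succ m ih =>
    rw [cycleCount, cycleCount, ← ih (-d - 1), ← ih (-d + 1)]
    ring_nf

lemma cycleCount_add (L m : ℕ) (d : ℤ) : cycleCount L m (d + L) = cycleCount L m d := by
  induction m generalizing d with
  | zero => simp [cycleCount]
  | succ m ih =>
    rw [cycleCount, cycleCount, ← ih (d - 1), ← ih (d + 1)]
    ring_nf

/-- The reflection principle for walks in a strip. -/
lemma bitCount_staysBelow {H : ℕ} (hH : 1 ≤ H) (m : ℕ) {i : ℕ} (hi : i ≤ H) :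
    (bitCount (m + 1) (StaysBelow H i) : ℤ) =
      cycleCount (2 * H) m ((i : ℤ) - 1) - cycleCount (2 * H) m ((i : ℤ) + 1) := by
  -- Inside the strip both sides obey the same recursion. The right side vanishes at `i = 0` by
  -- evenness and at `i = H` by evenness together with the period 2H: these are the two reflections.
  induction m generalizing i with
  | zero =>
    simp only [bitCount, StaysBelow, cycleCount]
    by_cases h : 0 < i ∧ i < H
    · have h2 : ¬ ((2 * H : ℕ) : ℤ) ∣ (i : ℤ) + 1 := fun hd => by
        have := Int.le_of_dvd (by omega) hd
        push_cast at this
        omega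
      rcases eq_or_ne i 1 with rfl | h1
      · simp [h] at h2 ⊢
        simp [h2]
      · have h3 : ¬ ((2 * H : ℕ) : ℤ) ∣ (i : ℤ) - 1 := fun hd => by
          have := Int.le_of_dvd (by omega) hd
          push_cast at this
          omega
        have h4 : i - 1 ≠ 0 := by omega
        rw [if_neg h2, if_neg h3]
        simp [h4]
    · have h' : i = 0 ∨ i = H := by omega
      rcases h' with rfl | rfl
      · simp
      · have : ((2 * i : ℕ) : ℤ) ∣ (i : ℤ) + 1 ↔ ((2 * i : ℕ) : ℤ) ∣ (i : ℤ) - 1 := by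
          rw [← dvd_neg, ← dvd_add_self_right]
          push_cast
          ring_nf
        rw [if_congr this rfl rfl]
        simp
  | succ m ih =>
    rw [bitCount]
    simp only [StaysBelow]
    by_cases h : 0 < i ∧ i < H
    · simp only [h, and_self, true_and, if_true, Bool.false_eq_true, if_false]
      push_cast
      rw [ih (i := i + 1) (by omega), ih (i := i - 1) (by omega), cycleCount, cycleCount]
      push_cast [Nat.cast_sub h.1]
      ring_nf
    · simp only [h, false_and, bitCount_false]
      have h' : i = 0 ∨ i = H := by omega
      rcases h' with rfl | rfl
      · rw [← cycleCount_neg _ _ (((0 : ℕ) : ℤ) + 1)]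
        simp
      · rw [← cycleCount_neg _ _ ((i : ℤ) + 1), ← cycleCount_add (2 * i) _ (-((i : ℤ) + 1))]
        push_cast
        ring_nf

/-- The number of walks of length `m` from `0` to `d` on the integers. -/
def lineCount : ℕ → ℤ → ℤ
  | 0, d => if d = 0 then 1 else 0
  | m + 1, d => lineCount m (d - 1) + lineCount m (d + 1)

lemma lineCount_neg (m : ℕ) (d : ℤ) : lineCount m (-d) = lineCount m d := by
  induction m generalizing d with
  | zero => simp [lineCount]
  | succ m ih =>
    rw [lineCount, lineCount, ← ih (-d - 1), ← ih (-d + 1)]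
    ring_nf

lemma lineCount_eq_zero {m : ℕ} {d : ℤ} (h : (m : ℤ) < d) : lineCount m d = 0 := by
  induction m generalizing d with
  | zero => simp at h; simp [lineCount, h.ne']
  | succ m ih => push_cast at h; rw [lineCount, ih (by omega), ih (by omega)]; rfl

lemma lineCount_eq_choose (m a : ℕ) : lineCount m (2 * a - m) = m.choose a := by
  induction m generalizing a with
  | zero =>
    rcases a with _ | a
    · simp [lineCount]
    · simp [lineCount]; omega
  | succ m ih =>
    rw [lineCount]
    rcases a with _ | a
    · rw [← lineCount_neg, lineCount_eq_zero (m := m) (by push_cast; omega)]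
      have := ih 0
      push_cast at this ⊢
      rw [show ((0 : ℤ) - ((m : ℤ) + 1) + 1) = 0 - m by ring, this]
      simp
    · have h1 := ih a
      have h2 := ih (a + 1)
      push_cast at h1 h2 ⊢
      rw [show (2 * ((a : ℤ) + 1) - ((m : ℤ) + 1) - 1) = 2 * a - m by ring, h1,
        show (2 * ((a : ℤ) + 1) - ((m : ℤ) + 1) + 1) = 2 * (a + 1) - m by ring, h2,
        Nat.choose_succ_succ]
      push_cast
      rfl

lemma lineCount_two_mul (n j : ℕ) : lineCount (2 * n) (2 * j) = (2 * n).choose (n + j) := by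
  rw [← lineCount_eq_choose]
  push_cast
  ring_nf

/-- A walk on the cycle lifts to the integers, its endpoint being free up to multiples of `L`. -/
lemma hasSum_lineCount {L : ℕ} (hL : 0 < L) (m : ℕ) (d : ℤ) :
    HasSum (fun k : ℤ => (lineCount m (d + k * L) : ℝ)) (cycleCount L m d) := by
  induction m generalizing d with
  | zero =>
    simp only [lineCount, cycleCount]
    split_ifs with h
    · obtain ⟨c, rfl⟩ := h
      have h1 : ∀ k, (L : ℤ) * c + k * L = 0 ↔ k = -c := by
        intro k
        rw [show (L : ℤ) * c + k * L = L * (c + k) by ring, mul_eq_zero]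
        omega
      simpa [h1] using hasSum_ite_eq (-c) (1 : ℝ)
    · have h1 : ∀ k : ℤ, d + k * L ≠ 0 := fun k h0 => h ⟨-k, by linarith⟩
      simp [h1]
  | succ m ih =>
    have := (ih (d - 1)).add (ih (d + 1))
    simp only [lineCount, cycleCount]
    push_cast
    simpa only [sub_add_eq_add_sub, add_right_comm d 1] using this

/-- The second difference of the row `2 n` of the Pascal triangle. -/
noncomputable def secondDiff (n : ℕ) (j : ℤ) : ℝ :=
  lineCount (2 * n) (2 * j + 2) - 2 * lineCount (2 * n) (2 * j) + lineCount (2 * n) (2 * j - 2)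

lemma secondDiff_neg (n : ℕ) (j : ℤ) : secondDiff n (-j) = secondDiff n j := by
  unfold secondDiff
  rw [← lineCount_neg _ (2 * -j + 2), ← lineCount_neg _ (2 * -j), ← lineCount_neg _ (2 * -j - 2)]
  ring_nf

/-- Discrete form of the second derivative of a Gaussian, and the source of the factor 4k²x² - 2.
Two Pascal steps express the entry of row 2n + 2 through three neighbours in row 2n, whose ratios
are rational. -/
lemma secondDiff_natCast (n j : ℕ) :
    secondDiff n j = (4 * (j : ℝ) ^ 2 - 2 * (n + 1)) / (2 * (n + 1) * (2 * n + 1)) *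
      (2 * (n + 1)).choose (n + 1 + j) := by
  rcases j with _ | j
  · have h1 := lineCount_two_mul n 1
    have h0 := lineCount_two_mul n 0
    have h2 := lineCount_neg (2 * n) (2 * (1 : ℕ))
    rw [h1] at h2
    unfold secondDiff
    push_cast at h0 h1 h2 ⊢
    rw [h1, h0, h2]
    have h3 : ((2 * (n + 1)).choose (n + 1) : ℝ) =
        2 * ((2 * n).choose n + (2 * n).choose (n + 1)) := by
      have h4 : (2 * n + 1).choose (n + 1) = (2 * n + 1).choose n := by
        rw [← Nat.choose_symm_of_eq_add]; omega
      rw [show 2 * (n + 1) = (2 * n + 1) + 1 by ring, Nat.choose_succ_succ, ← h4,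
        Nat.choose_succ_succ]
      push_cast
      ring
    have h5 : ((2 * n).choose (n + 1) : ℝ) * (n + 1) = (2 * n).choose n * n := by
      have := Nat.choose_succ_right_eq (2 * n) n
      rw [show 2 * n - n = n by omega] at this
      exact_mod_cast this
    rw [add_zero, add_zero, h3]
    field_simp
    push_cast
    linear_combination (4 * (n : ℝ) + 4) * h5
  · have hA := lineCount_two_mul n j
    have hM := lineCount_two_mul n (j + 1)
    have hD := lineCount_two_mul n (j + 2)
    unfold secondDiff
    push_cast at hA hM hD ⊢
    rw [show (2 * ((j : ℤ) + 1) + 2) = 2 * (j + 2) by ring, hD, hM,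
      show (2 * ((j : ℤ) + 1) - 2) = 2 * j by ring, hA]
    have h3 : ((2 * (n + 1)).choose (n + 1 + (j + 1)) : ℝ) =
        (2 * n).choose (n + j) + 2 * (2 * n).choose (n + (j + 1)) +
          (2 * n).choose (n + (j + 2)) := by
      rw [show 2 * (n + 1) = (2 * n + 1) + 1 by ring, show n + 1 + (j + 1) = n + j + 1 + 1 by ring,
        Nat.choose_succ_succ, Nat.choose_succ_succ, Nat.choose_succ_succ,
        show n + (j + 1) = n + j + 1 by ring, show n + (j + 2) = n + j + 1 + 1 by ring]
      push_cast
      ring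
    -- The real factor `n - i` is negative for `i > n`, where both coefficients vanish.
    have key : ∀ i, ((2 * n).choose (n + i + 1) : ℝ) * (n + i + 1) =
        (2 * n).choose (n + i) * (n - i) := by
      intro i
      rcases le_or_gt i n with hi | hi
      · have := Nat.choose_succ_right_eq (2 * n) (n + i)
        rw [show 2 * n - (n + i) = n - i by omega] at this
        rw [← Nat.cast_sub hi]
        exact_mod_cast this
      · rw [Nat.choose_eq_zero_of_lt (by omega : 2 * n < n + i + 1),
          Nat.choose_eq_zero_of_lt (by omega : 2 * n < n + i)]
        simp
    have k1 := key j
    have k2 := key (j + 1)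
    rw [h3]
    rw [show n + (j + 1) = n + j + 1 by ring, show n + (j + 2) = n + (j + 1) + 1 by ring]
    rw [show n + (j + 1) = n + j + 1 by ring] at k2 ⊢
    push_cast at k2 ⊢
    field_simp
    linear_combination (-4 * ((n : ℝ) + j + 2)) * k1 + (4 * ((n : ℝ) - j)) * k2

/-- The number of walks of length `2 n + 1` from `1` to `0` that stay in a strip, as a sum of
second differences of binomial coefficients. -/
lemma bitCount_staysBelow_eq {H : ℕ} (hH : 1 ≤ H) (n : ℕ) :
    HasSum (fun k : ℕ => secondDiff n ((k + 1) * H : ℕ))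
      (-secondDiff n 0 / 2 - bitCount (2 * n + 1) (StaysBelow H 1)) := by
  have h1 := bitCount_staysBelow hH (2 * n) hH
  have hL : 0 < 2 * H := by omega
  have s0 := hasSum_lineCount hL (2 * n) 0
  have s2 := hasSum_lineCount hL (2 * n) 2
  have s2' := hasSum_lineCount hL (2 * n) (-2)
  rw [cycleCount_neg] at s2'
  -- For `i = 1` the strip count is c(0) - c(2) on the cycle. Since c(-2) = c(2), minus twice this
  -- is the second difference of c, which unrolls to a sum over the integers.
  have hs : HasSum (fun k : ℤ => secondDiff n (k * H))
      (-2 * bitCount (2 * n + 1) (StaysBelow H 1)) := by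
    have h1' : (bitCount (2 * n + 1) (StaysBelow H 1) : ℝ) =
        cycleCount (2 * H) (2 * n) 0 - cycleCount (2 * H) (2 * n) 2 := by
      have h2 := congrArg (Int.cast : ℤ → ℝ) h1
      push_cast at h2
      simpa [one_add_one_eq_two] using h2
    have h2 : (fun k : ℤ => secondDiff n (k * H)) = fun k : ℤ =>
        (lineCount (2 * n) (2 + k * (2 * H : ℕ)) : ℝ) -
          2 * lineCount (2 * n) (0 + k * (2 * H : ℕ)) +
            lineCount (2 * n) (-2 + k * (2 * H : ℕ)) := by
      ext k
      unfold secondDiff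
      push_cast
      ring_nf
    rw [h1', h2, show (-2 * ((cycleCount (2 * H) (2 * n) 0 : ℝ) - cycleCount (2 * H) (2 * n) 2)) =
      cycleCount (2 * H) (2 * n) 2 - 2 * cycleCount (2 * H) (2 * n) 0 +
        cycleCount (2 * H) (2 * n) 2 by ring]
    exact (s2.sub (s0.mul_left 2)).add s2'
  -- Pairing `k` with `-k` counts `k = 0` twice; that term is removed and the rest is halved by
  -- evenness.
  have h0 := ((hasSum_nat_add_iff' 1).2 hs.nat_add_neg).div_const 2
  simp only [Finset.sum_range_one, Nat.cast_zero, neg_zero, zero_mul] at h0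
  have h3 : (fun k : ℕ => secondDiff n ((k + 1) * H : ℕ)) = fun k : ℕ =>
      (secondDiff n ((k + 1 : ℕ) * H) + secondDiff n (-((k + 1 : ℕ) : ℤ) * H)) / 2 := by
    ext k
    rw [neg_mul, secondDiff_neg]
    push_cast
    ring
  rw [h3]
  rw [show -secondDiff n 0 / 2 - (bitCount (2 * n + 1) (StaysBelow H 1) : ℝ) =
    (-2 * bitCount (2 * n + 1) (StaysBelow H 1) + secondDiff n 0 -
      (secondDiff n 0 + secondDiff n 0)) / 2 by ring]
  exact h0

end ParallelGW

/-! ### Uniformity of the bits and the exact law of the peak load -/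

namespace ParallelGW

open MeasureTheory ProbabilityTheory

section Bits

variable {Ω : Type*} [MeasurableSpace Ω] {μ : Measure Ω} {B : ℕ → Ω → Bool}

lemma measurableSet_bits (hB : ∀ k, Measurable (B k)) (I : List ℕ) (p : List Bool → Prop) :
    MeasurableSet {ω | p (I.map fun k => B k ω)} := by
  induction I generalizing p with
  | nil => simp
  | cons a I ih =>
    have : {ω | p ((a :: I).map fun k => B k ω)} =
        (B a ⁻¹' {true} ∩ {ω | p (true :: I.map fun k => B k ω)}) ∪
          (B a ⁻¹' {false} ∩ {ω | p (false :: I.map fun k => B k ω)}) := by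
      ext ω
      cases h : B a ω <;> simp [h]
    rw [this]
    exact (((hB a) (measurableSet_singleton _)).inter (ih fun l => p (true :: l))).union
      (((hB a) (measurableSet_singleton _)).inter (ih fun l => p (false :: l)))

lemma append_singleton_inj {α : Type*} {l l' : List α} {a b : α} :
    l ++ [a] = l' ++ [b] ↔ l = l' ∧ a = b := by
  refine ⟨fun h => by simpa using List.append_inj' h rfl, ?_⟩
  rintro ⟨rfl, rfl⟩
  rfl

lemma measure_bit_eq [IsProbabilityMeasure μ] (hB : ∀ k, Measurable (B k))
    (hfair : ∀ k, μ {ω | B k ω = true} = 1 / 2) (k : ℕ) (b : Bool) :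
    μ (B k ⁻¹' {b}) = 1 / 2 := by
  cases b
  · have h1 : B k ⁻¹' {false} = {ω | B k ω = true}ᶜ := by ext ω; simp
    have hm : MeasurableSet {ω | B k ω = true} := (hB k) (measurableSet_singleton true)
    rw [h1, prob_compl_eq_one_sub hm, hfair]
    simp
  · exact hfair k

lemma measureReal_cylinder [IsProbabilityMeasure μ] (hB : ∀ k, Measurable (B k))
    (hindep : iIndepFun B μ) (hfair : ∀ k, μ {ω | B k ω = true} = 1 / 2) (l : List Bool) :
    μ.real {ω | ((List.range l.length).map fun k => B k ω) = l} = (1 / 2) ^ l.length := by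
  have h1 : {ω | ((List.range l.length).map fun k => B k ω) = l} =
      ⋂ i ∈ Finset.range l.length, B i ⁻¹' {l.getD i false} := by
    ext ω
    simp only [Set.mem_ofPred_eq, Finset.mem_range, Set.mem_iInter, Set.mem_preimage,
      Set.mem_singleton_iff]
    constructor
    · intro h i hi
      rw [← h]
      simp [hi]
    · intro h
      refine List.ext_getElem (by simp) fun i hi hi' => ?_
      have := h i hi'
      rw [List.getD_eq_getElem _ _ hi'] at this
      simpa using this
  rw [h1, measureReal_def,
    hindep.measure_inter_preimage_eq_mul _ (fun i _ => measurableSet_singleton _)]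
  simp [measure_bit_eq hB hfair]

/-- A prefix `l` is kept fixed so that the induction can expose one further bit at a time;
independence enters only at `m = 0`, through cylinders. -/
lemma measureReal_bits_aux [IsProbabilityMeasure μ] (hB : ∀ k, Measurable (B k))
    (hindep : iIndepFun B μ) (hfair : ∀ k, μ {ω | B k ω = true} = 1 / 2) (m : ℕ) (l : List Bool)
    (p : List Bool → Prop) :
    μ.real {ω | ((List.range l.length).map fun k => B k ω) = l ∧
      p ((List.range' l.length m).map fun k => B k ω)} =
        bitCount m p * (1 / 2) ^ (l.length + m) := by
  induction m generalizing l p with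
  | zero =>
    by_cases hp : p []
    · simpa [bitCount, hp] using measureReal_cylinder hB hindep hfair l
    · simp [bitCount, hp]
  | succ m ih =>
    set S : Bool → Set Ω := fun b =>
      {ω | ((List.range (l ++ [b]).length).map fun k => B k ω) = l ++ [b] ∧
        p (b :: (List.range' (l ++ [b]).length m).map fun k => B k ω)} with hS
    have h1 : {ω | ((List.range l.length).map fun k => B k ω) = l ∧
        p ((List.range' l.length (m + 1)).map fun k => B k ω)} = S true ∪ S false := by
      ext ω
      simp only [hS, Set.mem_union, Set.mem_ofPred_eq, List.length_append, List.length_singleton,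
        List.range_succ, List.map_append, List.range'_succ, List.map_cons, List.map_nil]
      rw [append_singleton_inj, append_singleton_inj]
      cases h : B l.length ω <;> simp
    have hd : Disjoint (S true) (S false) := by
      rw [Set.disjoint_left]
      intro ω h h'
      have := h.1.symm.trans (by simpa using h'.1)
      simp at this
    have hm : ∀ b, MeasurableSet (S b) := fun b =>
      (measurableSet_bits hB _ fun l' => l' = l ++ [b]).inter
        (measurableSet_bits hB _ fun l' => p (b :: l'))
    rw [h1, measureReal_union hd (hm false), hS]
    have ht := ih (l ++ [true]) fun l' => p (true :: l')
    have hf := ih (l ++ [false]) fun l' => p (false :: l')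
    simp only at ht hf ⊢
    rw [ht, hf, bitCount]
    simp only [List.length_append, List.length_singleton]
    push_cast
    ring

/-- The first `m` of a sequence of independent fair bits are uniformly distributed. -/
lemma measureReal_bits [IsProbabilityMeasure μ] (hB : ∀ k, Measurable (B k))
    (hindep : iIndepFun B μ) (hfair : ∀ k, μ {ω | B k ω = true} = 1 / 2) (m : ℕ)
    (p : List Bool → Prop) :
    μ.real {ω | p ((List.range' 0 m).map fun k => B k ω)} = bitCount m p * (1 / 2) ^ m := by
  simpa using measureReal_bits_aux hB hindep hfair m [] p

lemma measurable_load (hB : ∀ k, Measurable (B k)) (t : ℕ) (σ : List Bool → ℕ × ℕ) (k : ℕ) :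
    Measurable fun ω => (state t σ (fun k => B k ω) k).load := by
  refine measurable_to_countable' fun m => ?_
  have : (fun ω => (state t σ (fun k => B k ω) k).load) ⁻¹' {m} =
      {ω | (fun l : List Bool => (state t σ (fun j => l.getD j false) k).load = m)
        ((List.range k).map fun k => B k ω)} := by
    ext ω
    simp only [Set.mem_preimage, Set.mem_singleton_iff, Set.mem_ofPred_eq]
    -- The state at time `k` reads only the first `k` bits, so the default `false` is never used.
    rw [state_congr (β' := fun j => ((List.range k).map fun k => B k ω).getD j false)]
    intro j hj
    simp [hj]
  rw [this]
  exact measurableSet_bits hB (List.range k)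
    fun l => (state t σ (fun j => l.getD j false) k).load = m

lemma measurable_peakLoad (hB : ∀ k, Measurable (B k)) (t : ℕ) (σ : List Bool → ℕ × ℕ) :
    Measurable fun ω => peakLoad t σ (fun k => B k ω) :=
  Measurable.iSup fun k => measurable_load hB t σ k

lemma measurableSet_generates (hB : ∀ k, Measurable (B k)) (t : ℕ) (σ : List Bool → ℕ × ℕ)
    (n : ℕ) : MeasurableSet {ω | Generates t σ n (fun k => B k ω)} := by
  simp only [generates_iff_staysBelow]
  exact measurableSet_bits hB _ _

/-- The ratio of the binomial coefficient at distance `j` from the centre of the row `2 N` to the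
central one. -/
noncomputable def binomRatio (N j : ℕ) : ℝ := (2 * N).choose (N + j) / (2 * N).choose N

/-- The probability that the maximal height of a uniform excursion of length `2 N` is at least
`h`. -/
noncomputable def excursionTail (N h : ℕ) : ℝ :=
  ∑' k : ℕ, (4 * (((k + 1) * h : ℕ) : ℝ) ^ 2 / N - 2) * binomRatio N ((k + 1) * h)

/-- The Catalan number. At the barrier 2n + 3 every term with k ≥ 1 lies beyond the end of the
binomial row, and only the central second difference survives. -/
lemma bitCount_excursion (n : ℕ) :
    (bitCount (2 * n + 1) (StaysBelow (2 * n + 3) 1) : ℝ) =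
      (2 * (n + 1)).choose (n + 1) / (2 * (2 * n + 1)) := by
  have h := bitCount_staysBelow_eq (H := 2 * n + 3) (by omega) n
  have h0 : (fun k : ℕ => secondDiff n ((k + 1) * (2 * n + 3) : ℕ)) = fun _ => 0 := by
    ext k
    have : 2 * n + 3 ≤ (k + 1) * (2 * n + 3) := Nat.le_mul_of_pos_left _ (by omega)
    rw [secondDiff_natCast, Nat.choose_eq_zero_of_lt (by omega)]
    simp
  rw [h0] at h
  have h1 := h.unique hasSum_zero
  have h2 := secondDiff_natCast n 0
  rw [Nat.cast_zero] at h2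
  rw [h2] at h1
  rw [← sub_eq_zero.1 h1]
  push_cast
  field_simp
  ring_nf

/-- After division by the Catalan number the central term becomes 1, and the series becomes the
probability of not staying below `H`. -/
lemma hasSum_excursionTail (n : ℕ) {H : ℕ} (hH : 1 ≤ H) :
    HasSum (fun k : ℕ => (4 * (((k + 1) * H : ℕ) : ℝ) ^ 2 / (n + 1 : ℕ) - 2) *
        binomRatio (n + 1) ((k + 1) * H))
      ((1 : ℝ) - (bitCount (2 * n + 1) (StaysBelow H 1) : ℝ) /
        (bitCount (2 * n + 1) (StaysBelow (2 * n + 3) 1) : ℝ)) := by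
  have h := (bitCount_staysBelow_eq hH n).div_const
    (bitCount (2 * n + 1) (StaysBelow (2 * n + 3) 1) : ℝ)
  have hpos : (0 : ℝ) < (2 * (n + 1)).choose (n + 1) := by
    exact_mod_cast Nat.choose_pos (by omega)
  have h2 := secondDiff_natCast n 0
  rw [Nat.cast_zero] at h2
  rw [sub_div] at h
  have h3 : -secondDiff n 0 / 2 / (bitCount (2 * n + 1) (StaysBelow (2 * n + 3) 1) : ℝ) = 1 := by
    rw [h2, bitCount_excursion]
    push_cast
    rw [add_zero]
    field_simp
    ring
  rw [h3] at h
  refine Eq.subst (motive := fun f => HasSum f _) (funext fun k => ?_) h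
  rw [secondDiff_natCast, bitCount_excursion, binomRatio]
  push_cast
  field_simp

/-- The law of the peak load, conditioned on the size of the tree. -/
lemma measureReal_cond_peakLoad [IsProbabilityMeasure μ] (hB : ∀ k, Measurable (B k))
    (hindep : iIndepFun B μ) (hfair : ∀ k, μ {ω | B k ω = true} = 1 / 2) (t : ℕ)
    (σ : List Bool → ℕ × ℕ) (n : ℕ) :
    μ {ω | Generates t σ n (fun k => B k ω)} ≠ 0 ∧ ∀ H, 1 ≤ H →
      (μ[|{ω | Generates t σ n (fun k => B k ω)}]).real {ω | H ≤ peakLoad t σ (fun k => B k ω)} =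
        excursionTail (n + 1) H := by
  set G := {ω | Generates t σ n (fun k => B k ω)} with hG
  have hGm : MeasurableSet G := measurableSet_generates hB t σ n
  have hpos : (0 : ℝ) < bitCount (2 * n + 1) (StaysBelow (2 * n + 3) 1) := by
    rw [bitCount_excursion]
    have : (0 : ℝ) < (2 * (n + 1)).choose (n + 1) := by
      exact_mod_cast Nat.choose_pos (by omega)
    positivity
  have hGr : μ.real G = bitCount (2 * n + 1) (StaysBelow (2 * n + 3) 1) * (1 / 2) ^ (2 * n + 1) := by
    rw [← measureReal_bits hB hindep hfair, hG]
    simp only [generates_iff_staysBelow]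
  have hG0 : μ G ≠ 0 := by
    intro h0
    rw [measureReal_def, h0] at hGr
    have : 0 < (bitCount (2 * n + 1) (StaysBelow (2 * n + 3) 1) : ℝ) * (1 / 2) ^ (2 * n + 1) := by
      positivity
    simp only [ENNReal.toReal_zero] at hGr
    linarith
  refine ⟨hG0, fun H hH => ?_⟩
  have : IsProbabilityMeasure (μ[|G]) := cond_isProbabilityMeasure hG0
  have hlt : (μ[|G]).real {ω | peakLoad t σ (fun k => B k ω) < H} =
      bitCount (2 * n + 1) (StaysBelow H 1) /
        bitCount (2 * n + 1) (StaysBelow (2 * n + 3) 1) := by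
    have h1 : G ∩ {ω | peakLoad t σ (fun k => B k ω) < H} =
        {ω | StaysBelow H 1 ((List.range' 0 (2 * n + 1)).map fun k => B k ω)} := by
      ext ω
      exact generates_and_peakLoad_lt_iff hH
    rw [measureReal_def, cond_apply hGm, ENNReal.toReal_mul, ENNReal.toReal_inv,
      ← measureReal_def, ← measureReal_def, h1, measureReal_bits hB hindep hfair, hGr]
    field_simp
  have hc : {ω | H ≤ peakLoad t σ (fun k => B k ω)} =
      {ω | peakLoad t σ (fun k => B k ω) < H}ᶜ := by
    ext ω; simp
  rw [hc, probReal_compl_eq_one_sub (measurableSet_lt (measurable_peakLoad hB t σ) measurable_const),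
    hlt]
  exact (hasSum_excursionTail n hH).tsum_eq.symm

end Bits

end ParallelGW

/-! ### Local limit of the binomial ratios and of the excursion tail -/

namespace ParallelGW

open Filter Topology

lemma binomRatio_zero (N : ℕ) : binomRatio N 0 = 1 := by
  have : ((2 * N).choose N : ℝ) ≠ 0 := by
    exact_mod_cast (Nat.choose_pos (by omega)).ne'
  simp [binomRatio, this]

lemma binomRatio_nonneg (N j : ℕ) : 0 ≤ binomRatio N j := by unfold binomRatio; positivity

lemma binomRatio_of_lt {N j : ℕ} (h : N < j) : binomRatio N j = 0 := by
  rw [binomRatio, Nat.choose_eq_zero_of_lt (by omega)]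
  simp

/-- The ratio as a product over the factors of the two factorials. -/
lemma binomRatio_eq_prod {N j : ℕ} (h : j ≤ N) :
    binomRatio N j = ∏ i ∈ Finset.range j, (1 - (j : ℝ) / (N + i + 1)) := by
  have h1 : (N + j).factorial = N.factorial * (N + 1).ascFactorial j :=
    (Nat.factorial_mul_ascFactorial N j).symm
  have h2 : N.factorial = (N - j).factorial * (N - j + 1).ascFactorial j := by
    rw [Nat.factorial_mul_ascFactorial, Nat.sub_add_cancel h]
  have h3 := Nat.choose_mul_factorial_mul_factorial (show N + j ≤ 2 * N by omega)
  have h4 := Nat.choose_mul_factorial_mul_factorial (show N ≤ 2 * N by omega)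
  rw [show 2 * N - (N + j) = N - j by omega] at h3
  rw [show 2 * N - N = N by omega, ← h3, h1] at h4
  have h5 : (2 * N).choose N * (N - j + 1).ascFactorial j =
      (2 * N).choose (N + j) * (N + 1).ascFactorial j := by
    have hp : 0 < N.factorial * (N - j).factorial :=
      Nat.mul_pos (Nat.factorial_pos _) (Nat.factorial_pos _)
    apply Nat.eq_of_mul_eq_mul_left hp
    calc N.factorial * (N - j).factorial * ((2 * N).choose N * (N - j + 1).ascFactorial j)
        = (2 * N).choose N * N.factorial * ((N - j).factorial * (N - j + 1).ascFactorial j) := by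
          ring
      _ = (2 * N).choose N * N.factorial * N.factorial := by rw [← h2]
      _ = _ := by rw [h4]; ring
  have hC : ((2 * N).choose N : ℝ) ≠ 0 := by exact_mod_cast (Nat.choose_pos (by omega)).ne'
  have hA : (((N + 1).ascFactorial j : ℕ) : ℝ) ≠ 0 := by
    exact_mod_cast (Nat.ascFactorial_pos N j).ne'
  have h6 : binomRatio N j = ((N - j + 1).ascFactorial j : ℕ) / ((N + 1).ascFactorial j : ℕ) := by
    rw [binomRatio, div_eq_div_iff hC hA]
    have : (((2 * N).choose N * (N - j + 1).ascFactorial j : ℕ) : ℝ) =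
      ((2 * N).choose (N + j) * (N + 1).ascFactorial j : ℕ) := by rw [h5]
    push_cast at this
    linarith
  rw [h6, Nat.ascFactorial_eq_prod_range, Nat.ascFactorial_eq_prod_range]
  push_cast
  rw [← Finset.prod_div_distrib]
  refine Finset.prod_congr rfl fun i _ => ?_
  have : (N : ℝ) + 1 + i ≠ 0 := by positivity
  have : (N : ℝ) + i + 1 ≠ 0 := by positivity
  push_cast [Nat.cast_sub h]
  field_simp
  ring

/-- Each factor of the product is at most 1 - j/(N + j), hence at most exp(-j/(N + j)). -/
lemma binomRatio_le {N j : ℕ} (h : j ≤ N) :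
    binomRatio N j ≤ Real.exp (-((j : ℝ) ^ 2 / (N + j))) := by
  rcases Nat.eq_zero_or_pos j with rfl | hj
  · simp [binomRatio_zero]
  have hj' : (0 : ℝ) < j := by exact_mod_cast hj
  have h' : (j : ℝ) ≤ N := by exact_mod_cast h
  rw [binomRatio_eq_prod h, show (-((j : ℝ) ^ 2 / (N + j))) = j * (-(j / (N + j))) by ring,
    Real.exp_nat_mul, ← Finset.card_range j, ← Finset.prod_const, Finset.card_range]
  refine Finset.prod_le_prod (fun i hi => ?_) fun i hi => ?_
  · rw [sub_nonneg, div_le_one (by positivity)]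
    have : (0 : ℝ) ≤ i := by positivity
    linarith
  · have hi : (i : ℝ) + 1 ≤ j := by exact_mod_cast Finset.mem_range.1 hi
    refine le_trans ?_ (Real.one_sub_le_exp_neg _)
    have : (j : ℝ) / (N + j) ≤ j / (N + i + 1) :=
      div_le_div_of_nonneg_left hj'.le (by positivity) (by linarith)
    linarith

lemma le_binomRatio {N j : ℕ} (h : j < N) :
    Real.exp (-((j : ℝ) ^ 2 / (N - j))) ≤ binomRatio N j := by
  have h' : (0 : ℝ) < N - j := by rw [sub_pos]; exact_mod_cast h
  have hj : (0 : ℝ) ≤ j := by positivity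
  have hN : (0 : ℝ) < N := by linarith
  rw [binomRatio_eq_prod h.le, show (-((j : ℝ) ^ 2 / (N - j))) = j * (-(j / (N - j))) by ring,
    Real.exp_nat_mul, ← Finset.card_range j, ← Finset.prod_const, Finset.card_range]
  refine Finset.prod_le_prod (fun i hi => (Real.exp_pos _).le) fun i hi => ?_
  -- With u = j/N: 1/(1 - u) = 1 + u/(1 - u) ≤ exp(u/(1 - u)).
  have h1 : Real.exp (-((j : ℝ) / (N - j))) ≤ 1 - j / N := by
    rw [Real.exp_neg, inv_le_comm₀ (Real.exp_pos _) (by rw [sub_pos, div_lt_one hN]; linarith)]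
    have : (1 - (j : ℝ) / N)⁻¹ = j / (N - j) + 1 := by field_simp; ring
    rw [this]
    exact Real.add_one_le_exp _
  have h2 : (j : ℝ) / (N + i + 1) ≤ j / N :=
    div_le_div_of_nonneg_left hj hN (by have : (0 : ℝ) ≤ i := by positivity
                                        linarith)
  linarith

/-- Halving the exponent (N + j ≤ 2N) buys a bound valid for all `j`, as the domination of the
series requires. -/
lemma binomRatio_le_exp (N j : ℕ) :
    binomRatio N j ≤ Real.exp (-((j : ℝ) ^ 2 / N) / 2) := by
  rcases le_or_gt j N with h | h
  · refine (binomRatio_le h).trans (Real.exp_le_exp.2 ?_)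
    rcases Nat.eq_zero_or_pos N with rfl | hN
    · simp at h; simp [h]
    have hN' : (0 : ℝ) < N := by exact_mod_cast hN
    have h' : (j : ℝ) ≤ N := by exact_mod_cast h
    have : (j : ℝ) ^ 2 / (N * 2) ≤ j ^ 2 / (N + j) :=
      div_le_div_of_nonneg_left (by positivity) (by positivity) (by linarith)
    rw [neg_div, div_div]
    linarith
  · rw [binomRatio_of_lt h]; positivity

/-- The local limit theorem for the central binomial coefficients. -/
lemma tendsto_binomRatio {N j : ℕ → ℕ} (hN : Tendsto N atTop atTop) {y : ℝ}
    (hj : Tendsto (fun n => (j n : ℝ) ^ 2 / N n) atTop (𝓝 (y ^ 2))) :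
    Tendsto (fun n => binomRatio (N n) (j n)) atTop (𝓝 (Real.exp (-y ^ 2))) := by
  have hN' : Tendsto (fun n => (N n : ℝ)) atTop atTop := tendsto_natCast_atTop_atTop.comp hN
  -- Convergence of j²/N with N → ∞ forces j/N → 0, so N + j and N - j can both be replaced by N in
  -- the two exponential bounds.
  have hq : Tendsto (fun n => (j n : ℝ) / N n) atTop (𝓝 0) := by
    have h1 : Tendsto (fun n => ((j n : ℝ) / N n) ^ 2) atTop (𝓝 0) := by
      have := hj.mul (tendsto_inv_atTop_zero.comp hN')
      rw [mul_zero] at this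
      refine this.congr fun n => ?_
      simp only [Function.comp]
      rw [div_pow, div_mul_eq_mul_div, ← div_eq_mul_inv, sq (N n : ℝ), div_div]
    have h2 := h1.sqrt
    rw [Real.sqrt_zero] at h2
    exact h2.congr fun n => Real.sqrt_sq (by positivity)
  have hpos : ∀ᶠ n in atTop, 0 < (N n : ℝ) := hN'.eventually_gt_atTop 0
  have hlt : ∀ᶠ n in atTop, (j n : ℝ) / N n < 1 := hq.eventually_lt_const one_pos
  have hup : Tendsto (fun n => Real.exp (-((j n : ℝ) ^ 2 / (N n + j n)))) atTop
      (𝓝 (Real.exp (-y ^ 2))) := by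
    have : Tendsto (fun n => Real.exp (-((j n : ℝ) ^ 2 / N n / (1 + j n / N n)))) atTop
        (𝓝 (Real.exp (-(y ^ 2 / (1 + 0))))) :=
      (Real.continuous_exp.tendsto _).comp (hj.div (hq.const_add 1) (by norm_num)).neg
    rw [add_zero, div_one] at this
    refine this.congr' ?_
    filter_upwards [hpos] with n hn
    congr 2
    field_simp
  have hlo : Tendsto (fun n => Real.exp (-((j n : ℝ) ^ 2 / (N n - j n)))) atTop
      (𝓝 (Real.exp (-y ^ 2))) := by
    have : Tendsto (fun n => Real.exp (-((j n : ℝ) ^ 2 / N n / (1 - j n / N n)))) atTop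
        (𝓝 (Real.exp (-(y ^ 2 / (1 - 0))))) :=
      (Real.continuous_exp.tendsto _).comp (hj.div (hq.const_sub 1) (by norm_num)).neg
    rw [sub_zero, div_one] at this
    refine this.congr' ?_
    filter_upwards [hpos, hlt] with n hn hl
    rw [div_lt_one hn] at hl
    have : (N n : ℝ) - j n ≠ 0 := by linarith
    congr 2
    field_simp
  refine tendsto_of_tendsto_of_tendsto_of_le_of_le' hlo hup ?_ ?_
  · filter_upwards [hpos, hlt] with n hn hl
    rw [div_lt_one hn] at hl
    exact le_binomRatio (by exact_mod_cast hl)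
  · filter_upwards [hpos, hlt] with n hn hl
    rw [div_lt_one hn] at hl
    exact binomRatio_le (by exact_mod_cast hl.le)

/-- A term of the series defining the tail is dominated by the inverse of its argument. -/
lemma abs_mul_exp_le {y : ℝ} (hy : 0 < y) {r : ℝ} (hr : 0 ≤ r) (hr' : r ≤ Real.exp (-y / 2)) :
    |(4 * y - 2) * r| ≤ 40 / y := by
  have h1 : |4 * y - 2| ≤ 4 * y + 2 := by rw [abs_le]; constructor <;> linarith
  -- A quadratic minorant of exp(y/2) is enough. Its leading term y²/8 gives 40/8 = 5 against the 4
  -- from (4y + 2) y.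
  have h2 : Real.exp (-y / 2) ≤ 1 / (1 + y / 2 + (y / 2) ^ 2 / 2) := by
    rw [neg_div, Real.exp_neg, ← one_div]
    exact one_div_le_one_div_of_le (by positivity) (Real.quadratic_le_exp_of_nonneg (by positivity))
  rw [abs_mul, abs_of_nonneg hr]
  calc |4 * y - 2| * r ≤ (4 * y + 2) * (1 / (1 + y / 2 + (y / 2) ^ 2 / 2)) :=
        mul_le_mul h1 (hr'.trans h2) hr (by positivity)
    _ ≤ 40 / y := by
        rw [mul_one_div, div_le_div_iff₀ (by positivity) hy]
        nlinarith

lemma abs_excursionTail_term_le {N j : ℕ} (hN : 0 < N) (hj : 0 < j) :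
    |(4 * (j : ℝ) ^ 2 / N - 2) * binomRatio N j| ≤ 40 * N / (j : ℝ) ^ 2 := by
  have hN' : (0 : ℝ) < N := by exact_mod_cast hN
  have hj' : (0 : ℝ) < j := by exact_mod_cast hj
  have := abs_mul_exp_le (y := (j : ℝ) ^ 2 / N) (by positivity) (binomRatio_nonneg N j)
    (binomRatio_le_exp N j)
  rw [mul_div_assoc]
  refine this.trans_eq ?_
  field_simp

lemma summable_inv_succ_sq : Summable fun k : ℕ => 1 / ((k : ℝ) + 1) ^ 2 := by
  have := (summable_nat_add_iff 1).2 (Real.summable_one_div_nat_pow.2 one_lt_two)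
  simpa using this

/-- The constant `40 ∑ 1 / k²`. -/
noncomputable def tailConst : ℝ := ∑' k : ℕ, 40 * (1 / ((k : ℝ) + 1) ^ 2)

lemma hasSum_tailConst : HasSum (fun k : ℕ => 40 * (1 / ((k : ℝ) + 1) ^ 2)) tailConst :=
  (summable_inv_succ_sq.mul_left 40).hasSum

lemma tailConst_nonneg : 0 ≤ tailConst := tsum_nonneg fun k => by positivity

lemma abs_excursionTail_le {N h : ℕ} (hN : 0 < N) (hh : 0 < h) :
    |excursionTail N h| ≤ tailConst * (N / (h : ℝ) ^ 2) := by
  have hh' : (0 : ℝ) < h := by exact_mod_cast hh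
  rw [← Real.norm_eq_abs]
  refine tsum_of_norm_bounded (hasSum_tailConst.mul_right _) fun k => ?_
  refine (abs_excursionTail_term_le hN (Nat.mul_pos (Nat.succ_pos k) hh)).trans_eq ?_
  push_cast
  field_simp

/-- The scaling limit of the tail of the maximal height of a uniform excursion. -/
lemma tendsto_excursionTail {N h : ℕ → ℕ} (hN : Tendsto N atTop atTop) {x : ℝ} (hx : 0 < x)
    (hh : Tendsto (fun n => (h n : ℝ) ^ 2 / N n) atTop (𝓝 (x ^ 2))) :
    Tendsto (fun n => excursionTail (N n) (h n)) atTop (𝓝 (thetaTail x)) := by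
  have hlow : ∀ᶠ n in atTop, x ^ 2 / 2 < (h n : ℝ) ^ 2 / N n :=
    hh.eventually_const_lt (by have := sq_pos_of_pos hx; linarith)
  have hpos : ∀ᶠ n in atTop, 0 < N n := hN.eventually_gt_atTop 0
  -- The majorant has N/h² replaced by 2/x², which is legitimate once h²/N exceeds x²/2.
  refine tendsto_tsum_of_dominated_convergence
    (bound := fun k : ℕ => 40 * (1 / ((k : ℝ) + 1) ^ 2) * (2 / x ^ 2))
    (hasSum_tailConst.mul_right _).summable (fun k => ?_) ?_
  · have h1 : Tendsto (fun n => (((k + 1) * h n : ℕ) : ℝ) ^ 2 / N n) atTop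
        (𝓝 ((((k : ℝ) + 1) * x) ^ 2)) := by
      rw [mul_pow]
      refine (hh.const_mul (((k : ℝ) + 1) ^ 2)).congr fun n => ?_
      push_cast
      ring
    have h2 := tendsto_binomRatio hN h1
    have h3 := ((h1.const_mul 4).sub_const 2).mul h2
    rw [mul_pow, ← mul_assoc] at h3
    refine h3.congr fun n => ?_
    rw [mul_div_assoc]
  · filter_upwards [hlow, hpos] with n hn hn0 k
    have hn0' : (0 : ℝ) < N n := by exact_mod_cast hn0
    have hx2 := sq_pos_of_pos hx
    have hhn : 0 < h n := by
      rcases Nat.eq_zero_or_pos (h n) with h0 | h0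
      · rw [h0] at hn
        simp at hn
        linarith
      · exact h0
    have hhn' : (0 : ℝ) < h n := by exact_mod_cast hhn
    refine (abs_excursionTail_term_le hn0 (Nat.mul_pos (Nat.succ_pos k) hhn)).trans ?_
    have : (N n : ℝ) / (h n : ℝ) ^ 2 ≤ 2 / x ^ 2 := by
      rw [div_lt_div_iff₀ (by positivity) hn0'] at hn
      rw [div_le_div_iff₀ (by positivity) (by positivity)]
      linarith
    calc _ = 40 * (1 / ((k : ℝ) + 1) ^ 2) * (N n / (h n : ℝ) ^ 2) := by
          push_cast
          field_simp
      _ ≤ _ := by gcongr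

end ParallelGW

/-! ### The function Θ: primitive, behaviour at 0 and at infinity, monotonicity -/

namespace ParallelGW

open Filter Topology Set

/-- The series `∑_{k ≥ 1} exp (-k² x²)`. -/
noncomputable def gaussSum (x : ℝ) : ℝ := ∑' k : ℕ, Real.exp (-(((k : ℝ) + 1) ^ 2 * x ^ 2))

/-- The sum of the inverse squares. -/
noncomputable def invSqSum : ℝ := ∑' k : ℕ, 1 / ((k : ℝ) + 1) ^ 2

lemma exp_neg_le_one_div {y : ℝ} (hy : 0 < y) : Real.exp (-y) ≤ 1 / y := by
  rw [Real.exp_neg, ← one_div]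
  exact one_div_le_one_div_of_le hy (by linarith [Real.add_one_le_exp y])

lemma exp_gauss_le (k : ℕ) {x : ℝ} (hx : 0 < x) :
    Real.exp (-(((k : ℝ) + 1) ^ 2 * x ^ 2)) ≤ 1 / ((k : ℝ) + 1) ^ 2 * (1 / x ^ 2) := by
  refine (exp_neg_le_one_div (by positivity)).trans_eq ?_
  field_simp

lemma summable_gaussSum {x : ℝ} (hx : 0 < x) :
    Summable fun k : ℕ => Real.exp (-(((k : ℝ) + 1) ^ 2 * x ^ 2)) :=
  Summable.of_nonneg_of_le (fun _ => (Real.exp_pos _).le) (fun k => exp_gauss_le k hx)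
    (summable_inv_succ_sq.mul_right _)

lemma gaussSum_nonneg (x : ℝ) : 0 ≤ gaussSum x := tsum_nonneg fun _ => (Real.exp_pos _).le

lemma gaussSum_le {x : ℝ} (hx : 0 < x) : gaussSum x ≤ invSqSum * (1 / x ^ 2) := by
  rw [gaussSum, invSqSum, ← tsum_mul_right]
  exact (summable_gaussSum hx).tsum_le_tsum (fun k => exp_gauss_le k hx)
    (summable_inv_succ_sq.mul_right _)

lemma tsum_int_of_even {f : ℤ → ℝ} {s : ℝ} (hf : ∀ n, f (-n) = f n)
    (h : HasSum (fun k : ℕ => f (k + 1)) s) : ∑' n, f n = f 0 + 2 * s := by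
  have h1 : HasSum (fun n : ℕ => f n) (s + ∑ i ∈ Finset.range 1, f i) :=
    (hasSum_nat_add_iff (f := fun n : ℕ => f n) 1).1 (by simpa using h)
  have h2 : HasSum (fun n : ℕ => f (-(n + 1))) s := by simpa only [hf] using h
  rw [(HasSum.of_nat_of_neg_add_one h1 h2).tsum_eq]
  simp
  ring

lemma tsum_int_exp {x : ℝ} (hx : 0 < x) :
    ∑' n : ℤ, Real.exp (-((n : ℝ) ^ 2 * x ^ 2)) = 1 + 2 * gaussSum x := by
  have h := tsum_int_of_even (f := fun n : ℤ => Real.exp (-((n : ℝ) ^ 2 * x ^ 2)))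
    (s := gaussSum x) (fun n => by push_cast; rw [neg_sq]) (by
      push_cast
      exact (summable_gaussSum hx).hasSum)
  rw [h]
  simp

/-- The functional equation of the theta function. -/
lemma two_mul_gaussSum {x : ℝ} (hx : 0 < x) :
    2 * x * gaussSum x = √Real.pi - x + 2 * √Real.pi * gaussSum (Real.pi / x) := by
  have hpi := Real.pi_pos
  -- Jacobi's identity at a = x²/π: then πa = x², and the dual exponent π/a is (π/x)².
  have h := Real.tsum_exp_neg_mul_int_sq (a := x ^ 2 / Real.pi) (by positivity)
  have h1 : ∀ n : ℤ, -Real.pi * (x ^ 2 / Real.pi) * (n : ℝ) ^ 2 = -((n : ℝ) ^ 2 * x ^ 2) := by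
    intro n; field_simp
  have h2 : ∀ n : ℤ, -Real.pi / (x ^ 2 / Real.pi) * (n : ℝ) ^ 2 =
      -((n : ℝ) ^ 2 * (Real.pi / x) ^ 2) := by
    intro n; field_simp
  simp only [h1, h2] at h
  rw [tsum_int_exp hx, tsum_int_exp (div_pos hpi hx), ← Real.sqrt_eq_rpow,
    Real.sqrt_div (by positivity), Real.sqrt_sq hx.le, one_div_div] at h
  have hx' := hx.ne'
  field_simp at h
  linarith

/-- The integral of the tail of the Theta law over `(x, ∞)`, extended to `x ≤ 0`. -/
noncomputable def thetaIntegral (x : ℝ) : ℝ :=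
  if x ≤ 0 then √Real.pi else 2 * x * gaussSum x

lemma thetaIntegral_of_pos {x : ℝ} (hx : 0 < x) : thetaIntegral x = 2 * x * gaussSum x := by
  rw [thetaIntegral, if_neg (not_le.2 hx)]

lemma thetaIntegral_zero : thetaIntegral 0 = √Real.pi := by simp [thetaIntegral]

lemma abs_thetaTail_term_le (k : ℕ) {x : ℝ} (hx : 0 < x) :
    |(4 * ((k : ℝ) + 1) ^ 2 * x ^ 2 - 2) * Real.exp (-(((k : ℝ) + 1) ^ 2 * x ^ 2))| ≤
      40 * (1 / ((k : ℝ) + 1) ^ 2) * (1 / x ^ 2) := by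
  have hy : 0 < ((k : ℝ) + 1) ^ 2 * x ^ 2 := by positivity
  have := abs_mul_exp_le hy (Real.exp_pos (-(((k : ℝ) + 1) ^ 2 * x ^ 2))).le
    (Real.exp_le_exp.2 (by linarith))
  rw [mul_assoc 4]
  refine this.trans_eq ?_
  field_simp

lemma abs_thetaTail_term_le_of_lt (k : ℕ) {c x : ℝ} (hc : 0 < c) (hx : c < x) :
    |(4 * ((k : ℝ) + 1) ^ 2 * x ^ 2 - 2) * Real.exp (-(((k : ℝ) + 1) ^ 2 * x ^ 2))| ≤
      40 * (1 / ((k : ℝ) + 1) ^ 2) * (1 / c ^ 2) := by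
  refine (abs_thetaTail_term_le k (hc.trans hx)).trans ?_
  gcongr

lemma abs_thetaTail_le {x : ℝ} (hx : 0 < x) : |thetaTail x| ≤ tailConst * (1 / x ^ 2) := by
  rw [← Real.norm_eq_abs]
  exact tsum_of_norm_bounded (hasSum_tailConst.mul_right _) fun k => abs_thetaTail_term_le k hx

lemma continuousAt_thetaTail {x : ℝ} (hx : 0 < x) : ContinuousAt thetaTail x := by
  have : ContinuousOn thetaTail (Ioi (x / 2)) := by
    unfold thetaTail
    refine continuousOn_tsum (fun k => by fun_prop)
      (hasSum_tailConst.mul_right (1 / (x / 2) ^ 2)).summable fun k y hy => ?_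
    exact abs_thetaTail_term_le_of_lt k (half_pos hx) hy
  exact this.continuousAt (Ioi_mem_nhds (by linarith))

/-- Termwise differentiation on (x/2, ∞), where the derivatives have a summable bound independent of
the point. -/
lemma hasDerivAt_thetaIntegral {x : ℝ} (hx : 0 < x) :
    HasDerivAt thetaIntegral (-thetaTail x) x := by
  have h : HasDerivAt
      (fun y => ∑' k : ℕ, 2 * y * Real.exp (-(((k : ℝ) + 1) ^ 2 * y ^ 2)))
      (∑' k : ℕ, -((4 * ((k : ℝ) + 1) ^ 2 * x ^ 2 - 2) *
        Real.exp (-(((k : ℝ) + 1) ^ 2 * x ^ 2)))) x := by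
    refine hasDerivAt_tsum_of_isPreconnected
      (g' := fun (k : ℕ) (y : ℝ) => -((4 * ((k : ℝ) + 1) ^ 2 * y ^ 2 - 2) *
        Real.exp (-(((k : ℝ) + 1) ^ 2 * y ^ 2))))
      (hasSum_tailConst.mul_right (1 / (x / 2) ^ 2)).summable
      (isOpen_Ioi (a := x / 2)) isPreconnected_Ioi (fun k y _ => ?_) (fun k y hy => ?_)
      (y₀ := x) (by simp only [mem_Ioi]; linarith) ((summable_gaussSum hx).mul_left _)
      (by simp only [mem_Ioi]; linarith)
    · have h1 : HasDerivAt (fun y : ℝ => -(((k : ℝ) + 1) ^ 2 * y ^ 2))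
          (-(((k : ℝ) + 1) ^ 2 * (2 * y))) y := by
        simpa using ((hasDerivAt_pow 2 y).const_mul (((k : ℝ) + 1) ^ 2)).fun_neg
      refine (((hasDerivAt_id' y).const_mul 2).mul h1.exp).congr_deriv ?_
      ring
    · rw [norm_neg]
      exact abs_thetaTail_term_le_of_lt k (half_pos hx) hy
  rw [tsum_neg] at h
  refine h.congr_of_eventuallyEq ?_
  filter_upwards [Ioi_mem_nhds hx] with y hy
  rw [thetaIntegral_of_pos hy, gaussSum, tsum_mul_left]

/-- The functional equation moves the behaviour at 0 to `gaussSum (π / x)`, whose argument is large.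
The crude inverse square bound there already gives an O(x²) error. -/
lemma thetaIntegral_bounds {x : ℝ} (hx : 0 < x) :
    √Real.pi - x ≤ thetaIntegral x ∧
      thetaIntegral x ≤ √Real.pi - x + 2 * √Real.pi * invSqSum / Real.pi ^ 2 * x ^ 2 := by
  have hpi := Real.pi_pos
  rw [thetaIntegral_of_pos hx, two_mul_gaussSum hx]
  have h1 := gaussSum_nonneg (Real.pi / x)
  have h2 := gaussSum_le (div_pos hpi hx)
  have h3 : 0 ≤ 2 * √Real.pi := by positivity
  constructor
  · nlinarith
  · have h4 := mul_le_mul_of_nonneg_left h2 h3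
    have h5 : 2 * √Real.pi * (invSqSum * (1 / (Real.pi / x) ^ 2)) =
        2 * √Real.pi * invSqSum / Real.pi ^ 2 * x ^ 2 := by
      field_simp
    linarith

lemma continuousWithinAt_thetaIntegral : ContinuousWithinAt thetaIntegral (Ici 0) 0 := by
  have h : Tendsto thetaIntegral (𝓝[>] 0) (𝓝 (√Real.pi)) := by
    have h1 : Tendsto (fun x : ℝ => √Real.pi - x) (𝓝[>] 0) (𝓝 (√Real.pi)) := by
      have : Continuous fun x : ℝ => √Real.pi - x := by fun_prop
      simpa using (this.tendsto 0).mono_left nhdsWithin_le_nhds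
    have h2 : Tendsto (fun x : ℝ => √Real.pi - x +
        2 * √Real.pi * invSqSum / Real.pi ^ 2 * x ^ 2) (𝓝[>] 0) (𝓝 (√Real.pi)) := by
      have : Continuous fun x : ℝ => √Real.pi - x +
        2 * √Real.pi * invSqSum / Real.pi ^ 2 * x ^ 2 := by fun_prop
      simpa using (this.tendsto 0).mono_left nhdsWithin_le_nhds
    refine tendsto_of_tendsto_of_tendsto_of_le_of_le' h1 h2 ?_ ?_
    · filter_upwards [self_mem_nhdsWithin] with x hx using (thetaIntegral_bounds hx).1
    · filter_upwards [self_mem_nhdsWithin] with x hx using (thetaIntegral_bounds hx).2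
  rw [continuousWithinAt_Ioi_iff_Ici.symm]
  rwa [ContinuousWithinAt, thetaIntegral_zero]

lemma tendsto_thetaIntegral_atTop : Tendsto thetaIntegral atTop (𝓝 0) := by
  have h : Tendsto (fun x : ℝ => 2 * invSqSum * x⁻¹) atTop (𝓝 0) := by
    simpa using tendsto_inv_atTop_zero.const_mul (2 * invSqSum)
  refine squeeze_zero' ?_ ?_ h
  · filter_upwards [eventually_gt_atTop 0] with x hx
    rw [thetaIntegral_of_pos hx]
    have := gaussSum_nonneg x
    positivity
  · filter_upwards [eventually_gt_atTop 0] with x hx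
    rw [thetaIntegral_of_pos hx]
    refine (mul_le_mul_of_nonneg_left (gaussSum_le hx) (by positivity)).trans_eq ?_
    field_simp

/-! ### The tail is a limit of tails -/

lemma StaysBelow.mono {H H' : ℕ} (h : H ≤ H') {l : List Bool} {i : ℕ} (hl : StaysBelow H i l) :
    StaysBelow H' i l := by
  induction l generalizing i with
  | nil => exact hl
  | cons b l ih => exact ⟨⟨hl.1.1, hl.1.2.trans_le h⟩, ih hl.2⟩

lemma bitCount_mono (m : ℕ) {p q : List Bool → Prop} (h : ∀ l, p l → q l) :
    bitCount m p ≤ bitCount m q := by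
  induction m generalizing p q with
  | zero =>
    by_cases hp : p []
    · simp [bitCount, hp, h _ hp]
    · simp [bitCount, hp]
  | succ m ih => exact add_le_add (ih fun l => h _) (ih fun l => h _)

lemma excursionTail_eq (n : ℕ) {H : ℕ} (hH : 1 ≤ H) :
    excursionTail (n + 1) H = 1 - (bitCount (2 * n + 1) (StaysBelow H 1) : ℝ) /
        (bitCount (2 * n + 1) (StaysBelow (2 * n + 3) 1) : ℝ) :=
  (hasSum_excursionTail n hH).tsum_eq

lemma excursionTail_anti (n : ℕ) {H H' : ℕ} (hH : 1 ≤ H) (h : H ≤ H') :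
    excursionTail (n + 1) H' ≤ excursionTail (n + 1) H := by
  rw [excursionTail_eq n hH, excursionTail_eq n (hH.trans h)]
  have : (bitCount (2 * n + 1) (StaysBelow H 1) : ℝ) ≤ bitCount (2 * n + 1) (StaysBelow H' 1) := by
    exact_mod_cast bitCount_mono _ fun l => StaysBelow.mono h
  gcongr

lemma excursionTail_le_one (n : ℕ) {H : ℕ} (hH : 1 ≤ H) : excursionTail (n + 1) H ≤ 1 := by
  rw [excursionTail_eq n hH, sub_le_self_iff]
  positivity

lemma excursionTail_nonneg (n : ℕ) {H : ℕ} (hH : 1 ≤ H) : 0 ≤ excursionTail (n + 1) H := by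
  -- Above height n + 1 all binomial ratios vanish; monotonicity in the height then gives the sign.
  have h0 : excursionTail (n + 1) (H + (n + 2)) = 0 := by
    unfold excursionTail
    convert tsum_zero with k
    rw [binomRatio_of_lt, mul_zero]
    have : H + (n + 2) ≤ (k + 1) * (H + (n + 2)) := Nat.le_mul_of_pos_left _ (by omega)
    omega
  rw [← h0]
  exact excursionTail_anti n hH (by omega)

lemma tendsto_ceil_sq_div {x : ℝ} (hx : 0 < x) :
    Tendsto (fun n : ℕ => ((⌈x * √n⌉₊ : ℕ) : ℝ) ^ 2 / (n + 1 : ℕ)) atTop (𝓝 (x ^ 2)) := by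
  have h1 : Tendsto (fun n : ℕ => √(n : ℝ)) atTop atTop :=
    Real.tendsto_sqrt_atTop.comp tendsto_natCast_atTop_atTop
  have h2 := (tendsto_nat_ceil_mul_div_atTop hx.le).comp h1
  have h3 := (h2.pow 2).mul (tendsto_natCast_div_add_atTop (1 : ℝ))
  rw [mul_one] at h3
  refine h3.congr' ?_
  filter_upwards [eventually_gt_atTop 0] with n hn
  have hn' : (0 : ℝ) < n := by exact_mod_cast hn
  simp only [Function.comp]
  rw [div_pow, Real.sq_sqrt hn'.le]
  push_cast
  field_simp

lemma tendsto_excursionTail_ceil {x : ℝ} (hx : 0 < x) :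
    Tendsto (fun n : ℕ => excursionTail (n + 1) ⌈x * √n⌉₊) atTop (𝓝 (thetaTail x)) :=
  tendsto_excursionTail (tendsto_add_atTop_nat 1) hx (tendsto_ceil_sq_div hx)

lemma one_le_ceil {x : ℝ} (hx : 0 < x) {n : ℕ} (hn : 0 < n) : 1 ≤ ⌈x * √n⌉₊ := by
  have : (0 : ℝ) < n := by exact_mod_cast hn
  exact Nat.one_le_iff_ne_zero.2 (Nat.ceil_pos.2 (by positivity)).ne'

/-- Inherited from the discrete tails; the alternating sign of the terms of the series hides it. -/
lemma thetaTail_anti {x y : ℝ} (hx : 0 < x) (hxy : x ≤ y) : thetaTail y ≤ thetaTail x := by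
  refine le_of_tendsto_of_tendsto (tendsto_excursionTail_ceil (hx.trans_le hxy))
    (tendsto_excursionTail_ceil hx) ?_
  filter_upwards [eventually_gt_atTop 0] with n hn
  refine excursionTail_anti n (one_le_ceil hx hn) (Nat.ceil_mono ?_)
  gcongr

lemma thetaTail_nonneg {x : ℝ} (hx : 0 < x) : 0 ≤ thetaTail x := by
  refine ge_of_tendsto (tendsto_excursionTail_ceil hx) ?_
  filter_upwards [eventually_gt_atTop 0] with n hn using excursionTail_nonneg n (one_le_ceil hx hn)

lemma thetaTail_le_one {x : ℝ} (hx : 0 < x) : thetaTail x ≤ 1 := by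
  refine le_of_tendsto (tendsto_excursionTail_ceil hx) ?_
  filter_upwards [eventually_gt_atTop 0] with n hn using excursionTail_le_one n (one_le_ceil hx hn)

lemma tendsto_thetaTail_atTop : Tendsto thetaTail atTop (𝓝 0) := by
  have h : Tendsto (fun x : ℝ => tailConst * (1 / x ^ 2)) atTop (𝓝 0) := by
    have := (tendsto_pow_atTop (α := ℝ) two_ne_zero).inv_tendsto_atTop.const_mul tailConst
    simpa using this
  refine squeeze_zero_norm' ?_ h
  filter_upwards [eventually_gt_atTop 0] with x hx using abs_thetaTail_le hx

/-- Mean value theorem for `thetaIntegral` on [0, x], whose mean slope there is at most -1 + O(x).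
-/
lemma exists_thetaTail_ge {x : ℝ} (hx : 0 < x) :
    ∃ c ∈ Ioo 0 x, 1 - 2 * √Real.pi * invSqSum / Real.pi ^ 2 * x ≤ thetaTail c := by
  have hcont : ContinuousOn thetaIntegral (Icc 0 x) := by
    intro y hy
    rcases hy.1.eq_or_lt with rfl | hy0
    · exact continuousWithinAt_thetaIntegral.mono Icc_subset_Ici_self
    · exact (hasDerivAt_thetaIntegral hy0).continuousAt.continuousWithinAt
  obtain ⟨c, hc, h⟩ := exists_hasDerivAt_eq_slope thetaIntegral (fun y => -thetaTail y) hx hcont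
    fun y hy => hasDerivAt_thetaIntegral hy.1
  refine ⟨c, hc, ?_⟩
  rw [thetaIntegral_zero, sub_zero, eq_div_iff hx.ne'] at h
  have := (thetaIntegral_bounds hx).2
  refine le_of_mul_le_mul_right ?_ hx
  nlinarith

lemma tendsto_thetaTail_zero : Tendsto thetaTail (𝓝[>] 0) (𝓝 1) := by
  rw [tendsto_order]
  constructor
  · intro a ha
    have h1 : Tendsto (fun x : ℝ => 1 - 2 * √Real.pi * invSqSum / Real.pi ^ 2 * x) (𝓝[>] 0)
        (𝓝 1) := by
      have : Continuous fun x : ℝ => 1 - 2 * √Real.pi * invSqSum / Real.pi ^ 2 * x := by fun_prop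
      simpa using (this.tendsto 0).mono_left nhdsWithin_le_nhds
    obtain ⟨x, hxa, hx⟩ := ((h1.eventually_const_lt ha).and self_mem_nhdsWithin).exists
    obtain ⟨c, hc, hc'⟩ := exists_thetaTail_ge hx
    -- A single point `c` with a large value suffices, as `thetaTail` is antitone.
    filter_upwards [Ioc_mem_nhdsGT hc.1] with y hy
    exact (hxa.trans_le hc').trans_le (thetaTail_anti hy.1 hy.2)
  · intro a ha
    filter_upwards [self_mem_nhdsWithin] with x hx using (thetaTail_le_one hx).trans_lt ha

lemma integrableOn_thetaTail : MeasureTheory.IntegrableOn thetaTail (Ioi 0) := by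
  have := MeasureTheory.integrableOn_Ioi_deriv_of_nonpos continuousWithinAt_thetaIntegral
    (fun x hx => hasDerivAt_thetaIntegral hx)
    (fun x hx => neg_nonpos.2 (thetaTail_nonneg hx)) tendsto_thetaIntegral_atTop
  exact MeasureTheory.integrable_neg_iff.1 this

/-- Fundamental theorem of calculus with boundary values √π at 0 and 0 at infinity. -/
lemma integral_thetaTail : ∫ x in Ioi 0, thetaTail x = √Real.pi := by
  have := MeasureTheory.integral_Ioi_of_hasDerivAt_of_nonpos continuousWithinAt_thetaIntegral
    (fun x hx => hasDerivAt_thetaIntegral hx)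
    (fun x hx => neg_nonpos.2 (thetaTail_nonneg hx)) tendsto_thetaIntegral_atTop
  rw [MeasureTheory.integral_neg, thetaIntegral_zero] at this
  linarith

end ParallelGW

/-! ### The Theta law, convergence in distribution and convergence of the mean -/

namespace ParallelGW

open Filter Topology Set MeasureTheory ProbabilityTheory

/-- The distribution function of the Theta law. -/
noncomputable def thetaCDF : StieltjesFunction ℝ where
  toFun x := if x ≤ 0 then 0 else 1 - thetaTail x
  mono' x y hxy := by
    dsimp only
    split_ifs with hx hy hy
    · exact le_rfl
    · linarith [thetaTail_le_one (not_le.1 hy)]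
    · exact absurd (hxy.trans hy) hx
    · linarith [thetaTail_anti (not_le.1 hx) hxy]
  right_continuous' x := by
    rcases lt_trichotomy x 0 with hx | rfl | hx
    · refine ContinuousAt.continuousWithinAt ?_
      refine (continuousAt_const (y := (0 : ℝ))).congr ?_
      filter_upwards [Iio_mem_nhds hx] with y hy
      rw [if_pos (le_of_lt hy)]
    · rw [← continuousWithinAt_Ioi_iff_Ici, ContinuousWithinAt, if_pos le_rfl]
      have := tendsto_thetaTail_zero.const_sub 1
      rw [sub_self] at this
      refine this.congr' ?_
      filter_upwards [self_mem_nhdsWithin] with y hy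
      rw [if_neg (not_le.2 hy)]
    · refine ContinuousAt.continuousWithinAt ?_
      have h : ContinuousAt (fun y => 1 - thetaTail y) x :=
        continuousAt_const.fun_sub (continuousAt_thetaTail hx)
      refine h.congr ?_
      filter_upwards [Ioi_mem_nhds hx] with y hy
      rw [if_neg (not_le.2 hy)]

lemma thetaCDF_of_nonpos {x : ℝ} (hx : x ≤ 0) : thetaCDF x = 0 := if_pos hx

lemma thetaCDF_of_pos {x : ℝ} (hx : 0 < x) : thetaCDF x = 1 - thetaTail x := if_neg (not_le.2 hx)

lemma tendsto_thetaCDF_atBot : Tendsto thetaCDF atBot (𝓝 0) := by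
  refine tendsto_const_nhds.congr' ?_
  filter_upwards [eventually_le_atBot 0] with x hx using (thetaCDF_of_nonpos hx).symm

lemma tendsto_thetaCDF_atTop : Tendsto thetaCDF atTop (𝓝 1) := by
  have := tendsto_thetaTail_atTop.const_sub 1
  rw [sub_zero] at this
  refine this.congr' ?_
  filter_upwards [eventually_gt_atTop 0] with x hx using (thetaCDF_of_pos hx).symm

/-- The Theta law. -/
noncomputable def thetaLaw : Measure ℝ := thetaCDF.measure

instance : IsProbabilityMeasure thetaLaw :=
  thetaCDF.isProbabilityMeasure tendsto_thetaCDF_atBot tendsto_thetaCDF_atTop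

lemma thetaLaw_Iic_zero : thetaLaw (Iic 0) = 0 := by
  rw [thetaLaw, StieltjesFunction.measure_Iic _ tendsto_thetaCDF_atBot, thetaCDF_of_nonpos le_rfl]
  simp

lemma thetaLaw_Ici {x : ℝ} (hx : 0 < x) : thetaLaw.real (Ici x) = thetaTail x := by
  have h : Function.leftLim thetaCDF x = 1 - thetaTail x := by
    refine leftLim_eq_of_tendsto ?_
    refine Tendsto.congr' ?_
      (Tendsto.const_sub 1 ((continuousAt_thetaTail hx).tendsto.mono_left nhdsWithin_le_nhds))
    filter_upwards [nhdsWithin_le_nhds (Ioi_mem_nhds hx)] with y hy using (thetaCDF_of_pos hy).symm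
  rw [measureReal_def, thetaLaw, StieltjesFunction.measure_Ici _ tendsto_thetaCDF_atTop, h,
    sub_sub_cancel, ENNReal.toReal_ofReal (thetaTail_nonneg hx)]

lemma isThetaLaw_thetaLaw : IsThetaLaw thetaLaw :=
  ⟨inferInstance, thetaLaw_Iic_zero, fun _ => thetaLaw_Ici⟩

lemma ae_thetaLaw_pos : ∀ᵐ x ∂thetaLaw, 0 < x := by
  have h : {x : ℝ | ¬ 0 < x} = Iic 0 := by ext x; simp
  rw [ae_iff, h, thetaLaw_Iic_zero]

/-- Layer cake formula: the mean of a nonnegative variable is the integral of its tail. -/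
lemma lintegral_thetaLaw : ∫⁻ x, ENNReal.ofReal x ∂thetaLaw = ENNReal.ofReal (√Real.pi) := by
  have h0 : 0 ≤ᵐ[thetaLaw] fun x => x := ae_thetaLaw_pos.mono fun x hx => le_of_lt hx
  rw [lintegral_eq_lintegral_meas_le thetaLaw h0 aemeasurable_id', ← integral_thetaTail,
    ofReal_integral_eq_lintegral_ofReal integrableOn_thetaTail
      ((ae_restrict_iff' measurableSet_Ioi).2 (ae_of_all _ fun x hx => thetaTail_nonneg hx))]
  refine setLIntegral_congr_fun measurableSet_Ioi fun x hx => ?_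
  change thetaLaw (Ici x) = _
  rw [← thetaLaw_Ici hx, measureReal_def, ENNReal.ofReal_toReal (measure_ne_top _ _)]

lemma integrable_thetaLaw : Integrable (fun x : ℝ => x) thetaLaw := by
  refine ⟨aestronglyMeasurable_id, ?_⟩
  rw [hasFiniteIntegral_iff_ofReal (ae_thetaLaw_pos.mono fun x hx => le_of_lt hx),
    lintegral_thetaLaw]
  exact ENNReal.ofReal_lt_top

lemma integral_thetaLaw : ∫ x, x ∂thetaLaw = √Real.pi := by
  rw [integral_eq_lintegral_of_nonneg_ae (ae_thetaLaw_pos.mono fun x hx => le_of_lt hx)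
    aestronglyMeasurable_id, lintegral_thetaLaw, ENNReal.toReal_ofReal (Real.sqrt_nonneg _)]

lemma isPiSystem_range_Ico : IsPiSystem (range fun p : ℝ × ℝ => Ico p.1 p.2) := by
  rintro _ ⟨p, rfl⟩ _ ⟨q, rfl⟩ _
  exact ⟨(max p.1 q.1, min p.2 q.2), Ico_inter_Ico.symm⟩

/-- Convergence of the tails `P (X ≥ x)` for every real `x` implies weak convergence. -/
lemma tendsto_probabilityMeasure_of_tendsto_Ici {ι : Type*} {l : Filter ι}
    [l.IsCountablyGenerated] {P : ι → ProbabilityMeasure ℝ} {Q : ProbabilityMeasure ℝ}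
    (h : ∀ x, Tendsto (fun i => (P i : Measure ℝ).real (Ici x)) l
      (𝓝 ((Q : Measure ℝ).real (Ici x)))) : Tendsto P l (𝓝 Q) := by
  -- Half-open intervals form a π-system containing arbitrarily small neighbourhoods of each point,
  -- and their measure is a difference of two tails.
  refine isPiSystem_range_Ico.tendsto_probabilityMeasure_of_tendsto_of_mem ?_ ?_ ?_
  · rintro _ ⟨p, rfl⟩
    exact measurableSet_Ico
  · intro u hu x hx
    obtain ⟨ε, hε, hb⟩ := Metric.isOpen_iff.1 hu x hx
    refine ⟨_, ⟨(x - ε / 2, x + ε / 2), rfl⟩, Ico_mem_nhds (by linarith) (by linarith), ?_⟩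
    intro y hy
    apply hb
    rw [Metric.mem_ball, Real.dist_eq, abs_lt]
    constructor <;> linarith [hy.1, hy.2]
  · rintro _ ⟨⟨a, b⟩, rfl⟩
    rcases le_or_gt b a with hba | hab
    · simpa [Ico_eq_empty (not_lt.2 hba)] using tendsto_const_nhds
    · have key : ∀ R : ProbabilityMeasure ℝ, (R : Measure ℝ).real (Ico a b) =
          (R : Measure ℝ).real (Ici a) - (R : Measure ℝ).real (Ici b) := by
        intro R
        rw [← Ici_sdiff_Ici, measureReal_sdiff (Ici_subset_Ici.2 hab.le) measurableSet_Ici]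
      have := (h a).sub (h b)
      simp only [← key] at this
      rw [← NNReal.tendsto_coe]
      exact this

section Conditional

variable {Ω : Type*} [MeasurableSpace Ω] {μ : Measure Ω} {B : ℕ → Ω → Bool}

lemma ae_cond_generates (hB : ∀ k, Measurable (B k)) (t : ℕ) (σ : List Bool → ℕ × ℕ) (n : ℕ) :
    ∀ᵐ ω ∂(μ[|{ω | Generates t σ n (fun k => B k ω)}]), Generates t σ n (fun k => B k ω) :=
  ae_cond_mem (measurableSet_generates hB t σ n)

lemma integrable_peakLoad (hB : ∀ k, Measurable (B k)) (t : ℕ) (σ : List Bool → ℕ × ℕ) (n : ℕ) :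
    Integrable (fun ω => (peakLoad t σ (fun k => B k ω) : ℝ))
      (μ[|{ω | Generates t σ n (fun k => B k ω)}]) := by
  refine Integrable.of_bound
    (measurable_from_nat.comp (measurable_peakLoad hB t σ)).aestronglyMeasurable (2 * n + 2 : ℕ) ?_
  filter_upwards [ae_cond_generates hB t σ n] with ω hω
  rw [Real.norm_natCast]
  exact_mod_cast hω.peakLoad_le_iff.2 hω.load_le

variable [IsProbabilityMeasure μ]

lemma measureReal_le_peakLoad_div (hB : ∀ k, Measurable (B k)) (hindep : iIndepFun B μ)
    (hfair : ∀ k, μ {ω | B k ω = true} = 1 / 2) (t : ℕ) (σ : List Bool → ℕ × ℕ) {n : ℕ}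
    (hn : 0 < n) {x : ℝ} (hx : 0 < x) :
    (μ[|{ω | Generates t σ n (fun k => B k ω)}]).real
      {ω | x ≤ (peakLoad t σ (fun k => B k ω) : ℝ) / √n} = excursionTail (n + 1) ⌈x * √n⌉₊ := by
  have hn' : (0 : ℝ) < √n := Real.sqrt_pos.2 (by exact_mod_cast hn)
  rw [← (measureReal_cond_peakLoad hB hindep hfair t σ n).2 _ (one_le_ceil hx hn)]
  congr 1
  ext ω
  simp only [mem_ofPred_eq]
  rw [le_div_iff₀ hn', Nat.ceil_le]

lemma tendsto_integral_peakLoad (hB : ∀ k, Measurable (B k)) (hindep : iIndepFun B μ)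
    (hfair : ∀ k, μ {ω | B k ω = true} = 1 / 2) (t : ℕ) (σ : List Bool → ℕ × ℕ) :
    Tendsto (fun n : ℕ => ∫ ω, (peakLoad t σ (fun k => B k ω) : ℝ) / √n
      ∂(μ[|{ω | Generates t σ n (fun k => B k ω)}])) atTop (𝓝 (√Real.pi)) := by
  rw [← integral_thetaTail]
  have hint : ∀ᶠ n : ℕ in atTop, ∫ x in Ioi 0, excursionTail (n + 1) ⌈x * √n⌉₊ =
      ∫ ω, (peakLoad t σ (fun k => B k ω) : ℝ) / √n
        ∂(μ[|{ω | Generates t σ n (fun k => B k ω)}]) := by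
    filter_upwards [eventually_gt_atTop 0] with n hn
    rw [((integrable_peakLoad hB t σ n).div_const _).integral_eq_integral_meas_le
      (ae_of_all _ fun ω => by positivity)]
    exact setIntegral_congr_fun measurableSet_Ioi fun x hx =>
      (measureReal_le_peakLoad_div hB hindep hfair t σ hn hx).symm
  refine Tendsto.congr' hint ?_
  have hmeas : ∀ n : ℕ, Measurable fun x : ℝ => excursionTail (n + 1) ⌈x * √n⌉₊ := fun n =>
    (measurable_from_nat (f := excursionTail (n + 1))).comp
      (Nat.measurable_ceil.comp (measurable_id.mul_const _))
  -- The majorant adds two bounds: the tail is at most 1, and x² times the tail is at most `2 *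
  -- tailConst`, the 2 coming from (n + 1)/n ≤ 2.
  refine tendsto_integral_filter_of_dominated_convergence
    (fun x => (1 + 2 * tailConst) * (1 + x ^ 2)⁻¹)
    (Eventually.of_forall fun n => (hmeas n).aestronglyMeasurable) ?_
    (integrable_inv_one_add_sq.const_mul _).integrableOn ?_
  · filter_upwards [eventually_gt_atTop 0] with n hn
    refine (ae_restrict_iff' measurableSet_Ioi).2 (ae_of_all _ fun x (hx : 0 < x) => ?_)
    have hn' : (1 : ℝ) ≤ n := by exact_mod_cast hn
    have h1 := one_le_ceil hx hn
    have h2 := excursionTail_nonneg n h1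
    have h3 := excursionTail_le_one n h1
    have h4 := (le_abs_self _).trans (abs_excursionTail_le (N := n + 1) (Nat.succ_pos n) h1)
    rw [Real.norm_of_nonneg h2, ← div_eq_mul_inv, le_div_iff₀ (by positivity)]
    have h5 : ((n + 1 : ℕ) : ℝ) / (⌈x * √n⌉₊ : ℝ) ^ 2 ≤ 2 / x ^ 2 := by
      have h6 : x ^ 2 * n ≤ (⌈x * √n⌉₊ : ℝ) ^ 2 := by
        have := pow_le_pow_left₀ (by positivity) (Nat.le_ceil (x * √n)) 2
        rwa [mul_pow, Real.sq_sqrt (by positivity)] at this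
      have h7 : (0 : ℝ) < ⌈x * √n⌉₊ := by exact_mod_cast h1
      rw [div_le_div_iff₀ (by positivity) (by positivity)]
      push_cast
      nlinarith [sq_nonneg x]
    have h8 : excursionTail (n + 1) ⌈x * √n⌉₊ * x ^ 2 ≤ 2 * tailConst := by
      have := h4.trans (mul_le_mul_of_nonneg_left h5 tailConst_nonneg)
      rw [← mul_div_assoc, le_div_iff₀ (by positivity)] at this
      linarith
    linarith
  · refine (ae_restrict_iff' measurableSet_Ioi).2 (ae_of_all _ fun x hx => ?_)
    exact tendsto_excursionTail_ceil hx

lemma tendstoInDistribution_peakLoad (hB : ∀ k, Measurable (B k)) (hindep : iIndepFun B μ)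
    (hfair : ∀ k, μ {ω | B k ω = true} = 1 / 2) (t : ℕ) (σ : List Bool → ℕ × ℕ)
    [∀ n, IsProbabilityMeasure (μ[|{ω | Generates t σ n (fun k => B k ω)}])] :
    TendstoInDistribution (fun (n : ℕ) (ω : Ω) => (peakLoad t σ (fun k => B k ω) : ℝ) / √n)
      atTop (fun x : ℝ => x) (fun n => μ[|{ω | Generates t σ n (fun k => B k ω)}]) thetaLaw := by
  have hm : ∀ n : ℕ, Measurable fun ω => (peakLoad t σ (fun k => B k ω) : ℝ) / √n := fun n =>
    (measurable_from_nat.comp (measurable_peakLoad hB t σ)).div_const _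
  refine ⟨fun n => (hm n).aemeasurable, aemeasurable_id', ?_⟩
  refine tendsto_probabilityMeasure_of_tendsto_Ici fun x => ?_
  simp only [ProbabilityMeasure.coe_mk, Measure.map_id']
  have hmap : ∀ n : ℕ, ((μ[|{ω | Generates t σ n (fun k => B k ω)}]).map fun ω =>
      (peakLoad t σ (fun k => B k ω) : ℝ) / √n).real (Ici x) =
      (μ[|{ω | Generates t σ n (fun k => B k ω)}]).real
        {ω | x ≤ (peakLoad t σ (fun k => B k ω) : ℝ) / √n} := fun n =>
    map_measureReal_apply (hm n) measurableSet_Ici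
  simp only [hmap]
  rcases lt_or_ge 0 x with hx | hx
  · rw [thetaLaw_Ici hx]
    refine (tendsto_excursionTail_ceil hx).congr' ?_
    filter_upwards [eventually_gt_atTop 0] with n hn
    exact (measureReal_le_peakLoad_div hB hindep hfair t σ hn hx).symm
  -- For x ≤ 0 both tails equal 1.
  · have h1 : thetaLaw.real (Ici x) = 1 := by
      rw [measureReal_def, (mem_ae_iff_prob_eq_one measurableSet_Ici).1, ENNReal.toReal_one]
      exact ae_thetaLaw_pos.mono fun y hy => hx.trans hy.le
    have h2 : ∀ n : ℕ, {ω | x ≤ (peakLoad t σ (fun k => B k ω) : ℝ) / √n} = univ := fun n =>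
      eq_univ_of_forall fun ω => hx.trans (by positivity)
    simp [h1, h2]

end Conditional

end ParallelGW

theorem mainTheorem6 {Ω : Type*} [MeasurableSpace Ω] (μ : MeasureTheory.Measure Ω)
    [MeasureTheory.IsProbabilityMeasure μ]
    (B : ℕ → Ω → Bool) (hB_meas : ∀ k, Measurable (B k))
    (hB_indep : ProbabilityTheory.iIndepFun B μ)
    (hB_fair : ∀ k, μ {ω | B k ω = true} = 1 / 2)
    (t : ℕ) (σ : List Bool → ℕ × ℕ) :
    -- the peak load is the maximum height of the associated excursion (a Dyck path)
    (∀ (n : ℕ) (β : ℕ → Bool), ParallelGW.Generates t σ n β →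
      ∃ p : DyckWord, p.semilength = n + 1 ∧ p.IsNested ∧
        p.toList = DyckStep.U :: (List.range (2 * n + 1)).map (fun k => ParallelGW.dyckStep (β k)) ∧
        (∀ k ≤ 2 * n + 1, (ParallelGW.state t σ β k).load = ParallelGW.heightAt p (k + 1)) ∧
        ParallelGW.peakLoad t σ β = ParallelGW.height p) ∧
    -- conditioning on the size is meaningful
    (∀ n : ℕ, MeasurableSet {ω | ParallelGW.Generates t σ n (fun k => B k ω)}) ∧
    ∃ _ : ∀ n : ℕ, MeasureTheory.IsProbabilityMeasure
        (ProbabilityTheory.cond μ {ω | ParallelGW.Generates t σ n (fun k => B k ω)}),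
      -- the mean peak load
      (∀ n : ℕ, MeasureTheory.Integrable
        (fun ω => (ParallelGW.peakLoad t σ (fun k => B k ω) : ℝ))
        (ProbabilityTheory.cond μ {ω | ParallelGW.Generates t σ n (fun k => B k ω)})) ∧
      Asymptotics.IsEquivalent Filter.atTop
        (fun n : ℕ => ∫ ω, (ParallelGW.peakLoad t σ (fun k => B k ω) : ℝ)
          ∂(ProbabilityTheory.cond μ {ω | ParallelGW.Generates t σ n (fun k => B k ω)}))
        (fun n : ℕ => Real.sqrt (Real.pi * n)) ∧
      -- the limit law
      ∃ (ν : MeasureTheory.Measure ℝ) (_ : MeasureTheory.IsProbabilityMeasure ν),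
        ParallelGW.IsThetaLaw ν ∧
        MeasureTheory.Integrable (fun x : ℝ => x) ν ∧ ∫ x, x ∂ν = Real.sqrt Real.pi ∧
        MeasureTheory.TendstoInDistribution
          (fun (n : ℕ) (ω : Ω) =>
            (ParallelGW.peakLoad t σ (fun k => B k ω) : ℝ) / Real.sqrt n)
          Filter.atTop (fun x : ℝ => x)
          (fun n : ℕ =>
            ProbabilityTheory.cond μ {ω | ParallelGW.Generates t σ n (fun k => B k ω)}) ν ∧
        MeasureTheory.TendstoInDistribution
          (fun (n : ℕ) (ω : Ω) =>
            (ParallelGW.peakLoad t σ (fun k => B k ω) : ℝ) / (2 * Real.sqrt (Real.pi * n)))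
          Filter.atTop (fun x : ℝ => x / (2 * Real.sqrt Real.pi))
          (fun n : ℕ =>
            ProbabilityTheory.cond μ {ω | ParallelGW.Generates t σ n (fun k => B k ω)}) ν := by
  have hprob : ∀ n : ℕ, MeasureTheory.IsProbabilityMeasure
      (ProbabilityTheory.cond μ {ω | ParallelGW.Generates t σ n (fun k => B k ω)}) := fun n =>
    ProbabilityTheory.cond_isProbabilityMeasure
      (ParallelGW.measureReal_cond_peakLoad hB_meas hB_indep hB_fair t σ n).1
  have hlaw := ParallelGW.tendstoInDistribution_peakLoad hB_meas hB_indep hB_fair t σ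
  refine ⟨fun n β h => ⟨h.excursion, h.semilength_excursion, h.isNested_excursion, rfl,
      fun k hk => (h.heightAt_excursion hk).symm, h.peakLoad_eq_height⟩,
    ParallelGW.measurableSet_generates hB_meas t σ, hprob,
    ParallelGW.integrable_peakLoad hB_meas t σ, ?_, ParallelGW.thetaLaw, inferInstance,
    ParallelGW.isThetaLaw_thetaLaw, ParallelGW.integrable_thetaLaw, ParallelGW.integral_thetaLaw,
    hlaw, ?_⟩
  · have hpi : (0 : ℝ) < Real.sqrt Real.pi := Real.sqrt_pos.2 Real.pi_pos
    rw [Asymptotics.isEquivalent_iff_tendsto_one]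
    · have h := (ParallelGW.tendsto_integral_peakLoad hB_meas hB_indep hB_fair t σ).div_const
        (Real.sqrt Real.pi)
      rw [div_self hpi.ne'] at h
      refine h.congr fun n => ?_
      simp only [Pi.div_apply]
      rw [MeasureTheory.integral_div, div_div, Real.sqrt_mul Real.pi_pos.le,
        mul_comm (Real.sqrt n)]
    · filter_upwards [Filter.eventually_gt_atTop 0] with n hn
      have : (0 : ℝ) < n := by exact_mod_cast hn
      positivity
  -- Continuous mapping by division by 2√π, since √(πn) = √π √n.
  · have h := hlaw.continuous_comp (g := fun x : ℝ => x / (2 * Real.sqrt Real.pi)) (by fun_prop)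
    convert h using 3 with n ω
    · simp only [Function.comp]
      rw [Real.sqrt_mul Real.pi_pos.le, div_div]
      ring_nf
    · rfl
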